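/- Let $(W,S)$ be a finite Coxeter system with Coxeter matrix $(m_{st})_{s,t\in S}$, length function $\ell$ and descent sets $D(w)=\{s\in S:\ell(ws)<\ell(w)\}$, and let $\mathbb F$ be a field. Let $H_W(0)$ be the $0$-Hecke algebra of $(W,S)$: the unital associative $\mathbb F$-algebra generated by $\{\pi_s:s\in S\}$ with relations $\pi_s^2=\pi_s$ for $s\in S$ and $(\pi_s\pi_t\pi_s\cdots)_{m_{st}}=(\pi_t\pi_s\pi_t\cdots)_{m_{st}}$ for distinct $s,t\in S$, where $(aba\cdots)_m$ is the alternating product of $m$ factors. Put $\overline\pi_s=\pi_s-1$, and for a reduced expression $w=s_1\cdots s_k$ put $\pi_w=\pi_{s_1}\cdots\pi_{s_k}$ and $\overline\pi_w=\overline\pi_{s_1}\cdots\overline\pi_{s_k}$; these do not depend on the reduced expression. For $I\subseteq S$ write $I^c=S\setminus I$, let $W_I=\langle I\rangle$, and let $w_0(I)$ be the longest element of $W_I$. For $J\subseteq S$ the algebra $H_{W_J}(0)$ is identified with the subalgebra of $H_W(0)$ generated by $\{\pi_s:s\in J\}$. Define the left modules $$\mathcal P^S_{I,J}=H_W(0)\,\overline\pi_{w_0(I)}\pi_{w_0(J\setminus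 I)},\qquad \mathcal P_I=H_W(0)\,\overline\pi_{w_0(I)}\pi_{w_0(I^c)}\qquad(I,J\subseteq S),$$ and, for $I\subseteq J\subseteq S$, the left $H_{W_J}(0)$-module $\mathcal P_I^J=H_{W_J}(0)\,\overline\pi_{w_0(I)}\pi_{w_0(J\setminus I)}$. (i) For all $I,J\subseteq S$, the elements $\overline\pi_w\pi_{w_0(J\setminus I)}$, indexed by the $w\in W$ with $I\subseteq D(w)\subseteq J^c\cup I$, form an $\mathbb F$-basis of $\mathcal P^S_{I,J}$. (ii) If $I\subseteq J\subseteq S$, then there are isomorphisms of left $H_W(0)$-modules $$H_W(0)\otimes_{H_{W_J}(0)}\mathcal P_I^J\;\cong\;\mathcal P^S_{I,J}\;\cong\;\bigoplus_{K\subseteq J^c}\mathcal P_{I\cup K}.$$ -/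

import Mathlib

open scoped TensorProduct DirectSum

namespace ZeroHecke

section Algebra

variable (F : Type*) [Field F] {B : Type*} (M : CoxeterMatrix B)

/-- The defining relations of the 0-Hecke algebra on the free algebra with generators `π_s`:
`π_s ^ 2 = π_s`, and for `s ≠ t` the two alternating products of `π_s` and `π_t` with `m_{st}`
factors agree. -/
inductive Rel : FreeAlgebra F B → FreeAlgebra F B → Prop
  | quadratic (s : B) : Rel (FreeAlgebra.ι F s * FreeAlgebra.ι F s) (FreeAlgebra.ι F s)
  | braid (s t : B) (h : s ≠ t) :
      Rel ((CoxeterSystem.braidWord M s t).map (FreeAlgebra.ι F)).prod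
        ((CoxeterSystem.braidWord M t s).map (FreeAlgebra.ι F)).prod

/-- The 0-Hecke algebra `H_W(0)` over the field `F` of a Coxeter system with matrix `M`. -/
def Hecke : Type _ := RingQuot (Rel F M)

noncomputable instance : Ring (Hecke F M) := inferInstanceAs (Ring (RingQuot (Rel F M)))

noncomputable instance : Algebra F (Hecke F M) :=
  inferInstanceAs (Algebra F (RingQuot (Rel F M)))

/-- The quotient map from the free algebra. -/
noncomputable def mk : FreeAlgebra F B →ₐ[F] Hecke F M := RingQuot.mkAlgHom F (Rel F M)

/-- The generator `π_s`. -/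
noncomputable def gen (s : B) : Hecke F M := mk F M (FreeAlgebra.ι F s)

/-- For a set `J` of simple reflections, the 0-Hecke algebra `H_{W_J}(0)` of the parabolic
subsystem `(W_J, J)`, as the subalgebra of `H_W(0)` generated by the `π_s` with `s ∈ J`. -/
noncomputable def parabolicAlgebra (J : Set B) : Subalgebra F (Hecke F M) :=
  Algebra.adjoin F (gen F M '' J)

end Algebra

section Coxeter

variable {B : Type*} {M : CoxeterMatrix B} {W : Type*} [Group W] (cs : CoxeterSystem M W)

/-- The descent set `D(w) = {s | ℓ(ws) < ℓ(w)}`. -/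
def descentSet (w : W) : Set B := {s | cs.IsRightDescent w s}

/-- The parabolic subgroup `W_I`. -/
def parabolicSubgroup (I : Set B) : Subgroup W := Subgroup.closure (cs.simple '' I)

theorem exists_longest [Finite W] (I : Set B) :
    ∃ w ∈ parabolicSubgroup cs I, ∀ v ∈ parabolicSubgroup cs I, cs.length v ≤ cs.length w :=
  Set.exists_max_image (parabolicSubgroup cs I : Set W) cs.length (Set.toFinite _)
    ⟨1, (parabolicSubgroup cs I).one_mem⟩

/-- The longest element `w_0(I)` of the parabolic subgroup `W_I` of a finite Coxeter group. -/
noncomputable def longest [Finite W] (I : Set B) : W := (exists_longest cs I).choose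

/-- A reduced word of `w`. By the word property of Coxeter groups, the products `piElt` and
`piBarElt` below are the same for every reduced word of `w`. -/
noncomputable def reducedWord (w : W) : List B := (cs.exists_isReduced w).choose

variable (F : Type*) [Field F]

/-- `π_w`, the product of the `π_s` along a reduced word of `w`. -/
noncomputable def piElt (w : W) : Hecke F M := ((reducedWord cs w).map (gen F M)).prod

/-- `π̄_w`, the product of the `π̄_s = π_s - 1` along a reduced word of `w`. -/
noncomputable def piBarElt (w : W) : Hecke F M :=
  ((reducedWord cs w).map fun s => gen F M s - 1).prod

variable [Finite W]

/-- The element `π̄_{w_0(I)} π_{w_0(J \ I)}` of `H_W(0)`. -/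
noncomputable def projGen (I J : Set B) : Hecke F M :=
  piBarElt cs F (longest cs I) * piElt cs F (longest cs (J \ I))

/-- The left ideal `H_W(0) π̄_{w_0(I)} π_{w_0(J \ I)}` of `H_W(0)`. -/
noncomputable def projIJ (I J : Set B) : Submodule (Hecke F M) (Hecke F M) :=
  Submodule.span (Hecke F M) {projGen cs F I J}

/-- The left ideal `P_I = H_W(0) π̄_{w_0(I)} π_{w_0(S \ I)}` of `H_W(0)`. -/
noncomputable def projI (I : Set B) : Submodule (Hecke F M) (Hecke F M) :=
  Submodule.span (Hecke F M)
    {piBarElt cs F (longest cs I) * piElt cs F (longest cs Iᶜ)}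

/-- For `I ⊆ J`, the left `H_{W_J}(0)`-module `H_{W_J}(0) π̄_{w_0(I)} π_{w_0(J \ I)}`. -/
noncomputable def projParabolic (I J : Set B) :
    Submodule (parabolicAlgebra F M J) (Hecke F M) :=
  Submodule.span (parabolicAlgebra F M J) {projGen cs F I J}

end Coxeter

section Induction

variable {F A : Type*} [Field F] [Ring A] [Algebra F A]

/-- The induced `A`-module `A ⊗_C N` of a left module `N` over a subalgebra `C` of an `F`-algebra
`A`: the quotient of `A ⊗_F N` by the relations `ac ⊗ n = a ⊗ cn`, with `A` acting on the
left factor. (Mathlib has tensor products over commutative rings only.) -/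
abbrev Induced (C : Subalgebra F A) (N : Type*) [AddCommGroup N] [Module F N] [Module C N]
    [IsScalarTower F C N] : Type _ :=
  (A ⊗[F] N) ⧸ Submodule.span A
    {x : A ⊗[F] N | ∃ (a : A) (c : C) (n : N), x = (a * (c : A)) ⊗ₜ[F] n - a ⊗ₜ[F] (c • n)}

end Induction

end ZeroHecke

/-! Everything is read off from the right regular action on the basis `π̄_w`. If `i ∈ D(w)`, then
`π̄_i` multiplies `π̄_w` by `-1` and `π_i = π̄_i + 1` kills it. If `i ∉ D(w)`, then `π̄_i` sends
`π̄_w` to the longer `π̄_{w s_i}`, and `π_i` fixes `π̄_w` modulo longer terms. Put `z = π̄_{w_0(I)}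
π_{w_0(J \ I)}`. Left multiples of `π̄_{w_0(I)}` involve only those `w` with `I ⊆ D(w)`, and
`π_{w_0(J \ I)}` kills those that also have a descent in `J \ I`; this gives the spanning half of
(i). For the remaining `w`, right multiplication by `π_{w_0(J \ I)}`, and up to sign by `z`,
preserves the leading term `π̄_w`, whence independence (`linearIndependent_of_hasLeadingTerm`).

The direct sum maps to `H z` through right multiplication by `z` on each `P_{I ∪ K}`. The index set
of (i) is partitioned by `D(w) = I ∪ K`, so the images of the bases have distinct leading terms, and
a dimension count finishes. For induction, right multiplication by `z` is injective on `H z`, so in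
finite dimension `z = z c z` with `c ∈ H_{W_J}(0)`. Then `a z = 0` forces `a ⊗ z = a z c ⊗ z = 0`,
with no appeal to freeness over the parabolic subalgebra.

That the `π̄_w` form a basis rests on Matsumoto's theorem and on the Demazure action on `F[W]`,
which bounds the dimension below by `|W|`. Both need that `s_i s_j` has order exactly `m_{ij}`. -/

namespace ZeroHecke

/-! ### The geometric representation and the order of `s_i s_j`. -/

section Geometric

open Polynomial.Chebyshev Module

variable {B : Type*} (M : CoxeterMatrix B)

/-- The linear form `v ↦ 2 ⟨α_i, v⟩` on the space of the geometric representation. -/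
noncomputable def coroot (i : B) : Dual ℝ (B →₀ ℝ) :=
  Finsupp.linearCombination ℝ fun j => -2 * Real.cos (Real.pi / M i j)

theorem coroot_single (i j : B) :
    coroot M i (Finsupp.single j 1) = -2 * Real.cos (Real.pi / M i j) := by
  simp [coroot]

theorem coroot_self (i : B) : coroot M i (Finsupp.single i 1) = 2 := by
  simp [coroot_single]

/-- The reflection attached to a generator in the geometric representation. -/
noncomputable def geomReflection (i : B) : (B →₀ ℝ) ≃ₗ[ℝ] (B →₀ ℝ) :=
  Module.reflection (coroot_self M i)

theorem coroot_mul_coroot (i j : B) :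
    coroot M i (Finsupp.single j 1) * coroot M j (Finsupp.single i 1) - 2 =
      2 * Real.cos (2 * (Real.pi / M i j)) := by
  rw [coroot_single, coroot_single, M.symmetric j i, Real.cos_two_mul]
  ring

theorem two_le_coxeterMatrix {i j : B} (hij : i ≠ j) (h0 : M i j ≠ 0) : 2 ≤ M i j := by
  have := M.off_diagonal i j hij
  omega

theorem sin_two_mul_pi_div_pos {m : ℕ} (hm : 3 ≤ m) : 0 < Real.sin (2 * (Real.pi / m)) := by
  have h3 : (3 : ℝ) ≤ m := by exact_mod_cast hm
  have hpi := Real.pi_pos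
  apply Real.sin_pos_of_pos_of_lt_pi
  · positivity
  · rw [← mul_div_assoc, div_lt_iff₀ (by linarith)]
    nlinarith

/-- Powers of a product of two reflections have coefficients given by the Chebyshev polynomials
`S_n` at `2 cos θ`, `θ = 2π/m`, where `S_n(2 cos θ) sin θ = sin((n+1)θ)`. The case `m = 2` is
separate because `sin θ = 0` there. -/
theorem geomReflection_isLiftable : M.IsLiftable (geomReflection M) := by
  intro i j
  by_cases hij : i = j
  · subst hij
    rw [M.diagonal, pow_one]
    apply LinearEquiv.ext
    intro z
    exact Module.involutive_reflection (coroot_self M i) z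
  by_cases h0 : M i j = 0
  · rw [h0, pow_zero]
  have h2 := two_le_coxeterMatrix M hij h0
  rcases h2.eq_or_lt with h2 | h3
  · rw [← h2]
    have hc : coroot M i (Finsupp.single j 1) = 0 := by rw [coroot_single, ← h2]; simp
    have hc' : coroot M j (Finsupp.single i 1) = 0 := by
      rw [coroot_single, M.symmetric j i, ← h2]; simp
    apply LinearEquiv.ext
    intro z
    simp only [pow_two, LinearEquiv.mul_apply, geomReflection, Module.reflection_apply, map_sub,
      map_smul, hc, hc', coroot_self, LinearEquiv.coe_one, id]
    module
  · have hs := (sin_two_mul_pi_div_pos h3).ne'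
    have hm : (M i j : ℝ) ≠ 0 := by exact_mod_cast h0
    apply LinearEquiv.ext
    intro z
    rw [geomReflection, geomReflection, Module.reflection_mul_reflection_pow_apply (coroot_self M i)
      (coroot_self M j) (M i j) z _ (coroot_mul_coroot M i j).symm]
    have hS (n : ℤ) := S_two_mul_real_cos (2 * (Real.pi / M i j)) n
    -- The vanishing factor is `S_{p-1}` when `m = 2p`, from `sin π = 0`, and `S_p + S_{p-1}` when
    -- `m = 2p + 1`, from `sin(π + π/m) + sin(π - π/m) = 0`.
    obtain ⟨p, hp | hp⟩ := Nat.even_or_odd' (M i j)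
    · have e1 : ((M i j : ℤ) - 2) / 2 = p - 1 := by omega
      have e2 : ((M i j : ℤ) - 1) / 2 = p - 1 := by omega
      have h : (S ℝ ((p : ℤ) - 1)).eval (2 * Real.cos (2 * (Real.pi / M i j))) = 0 := by
        apply (mul_eq_zero.1 ((hS _).trans _)).resolve_right hs
        rw [← Real.sin_pi]
        congr 1
        have : (M i j : ℝ) = 2 * p := by exact_mod_cast hp
        have hp0 : (p : ℝ) ≠ 0 := fun h => hm (by rw [this, h, mul_zero])
        rw [this]
        push_cast
        field_simp
        ring
      rw [e1, e2, h]
      simp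
    · have e1 : ((M i j : ℤ) - 2) / 2 = p - 1 := by omega
      have e2 : ((M i j : ℤ) - 1) / 2 = p := by omega
      have e3 : ((M i j : ℤ) - 3) / 2 = p - 1 := by omega
      have e4 : ((M i j : ℤ)) / 2 = p := by omega
      have h : (S ℝ (p : ℤ)).eval (2 * Real.cos (2 * (Real.pi / M i j))) +
          (S ℝ ((p : ℤ) - 1)).eval (2 * Real.cos (2 * (Real.pi / M i j))) = 0 := by
        apply (mul_eq_zero.1 (_ : _ * Real.sin (2 * (Real.pi / M i j)) = 0)).resolve_right hs
        rw [add_mul, hS, hS]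
        have : (M i j : ℝ) = 2 * p + 1 := by exact_mod_cast hp
        have e5 : ((p : ℤ) + 1 : ℝ) * (2 * (Real.pi / M i j)) = Real.pi + Real.pi / M i j := by
          rw [this] at hm ⊢
          push_cast
          field_simp
          ring
        have e6 : (((p : ℤ) - 1 : ℤ) + 1 : ℝ) * (2 * (Real.pi / M i j)) =
            Real.pi - Real.pi / M i j := by
          rw [this] at hm ⊢
          push_cast
          field_simp
          ring
        rw [e5, e6, Real.sin_pi_sub, add_comm Real.pi, Real.sin_add_pi]
        ring
      rw [e1, e2, e3, e4, h]
      simp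

/-- Evaluate the power at `α_i` and compare coordinates: `S_k + S_{k-1} = 1` and `S_{k-1} cos(π/m) =
0`. For `m ≥ 3` these give `cos(kθ) = 1`. -/
theorem dvd_of_geomReflection_pow {i j : B} (hij : i ≠ j) {k : ℕ}
    (h : (geomReflection M i * geomReflection M j) ^ k = 1) : M i j ∣ k := by
  have h1 := Module.reflection_mul_reflection_pow_apply_self (coroot_self M i) (coroot_self M j) k
    _ (coroot_mul_coroot M i j).symm
  change ((geomReflection M i * geomReflection M j) ^ k) _ = _ at h1
  rw [h] at h1
  have hi := DFunLike.congr_fun h1 i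
  have hj := DFunLike.congr_fun h1 j
  simp only [LinearEquiv.coe_one, id, Finsupp.coe_add, Finsupp.coe_smul, Pi.add_apply,
    Pi.smul_apply, Finsupp.single_eq_same, Finsupp.single_eq_of_ne hij,
    Finsupp.single_eq_of_ne (Ne.symm hij), smul_eq_mul, mul_one, mul_zero, add_zero, zero_add,
    coroot_single, M.symmetric j i] at hi hj
  have h12 : M i j = 0 ∨ M i j = 2 ∨ 3 ≤ M i j := by
    have := M.off_diagonal i j hij
    omega
  -- `m = 0` encodes infinite order. There `π / 0 = 0` makes the argument of `S` equal to `2`, where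
  -- `S_{k-1}` takes the value `k`.
  rcases h12 with h0 | h2 | h3
  · rw [h0] at hj ⊢
    norm_num [S_eval_two] at hj
    simp [hj]
  · rw [h2] at hi ⊢
    have e : 2 * Real.cos (2 * (Real.pi / ((2 : ℕ) : ℝ))) = -2 := by
      rw [Nat.cast_ofNat, mul_div_cancel₀ _ (two_ne_zero' ℝ), Real.cos_pi]
      ring
    rw [e, S_eval_neg_two, S_eval_neg_two, Int.negOnePow_sub] at hi
    by_contra hk
    have hodd : Odd (k : ℤ) := by
      rw [Int.odd_coe_nat, ← Nat.not_even_iff_odd]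
      exact fun hh => hk hh.two_dvd
    rw [Int.negOnePow_odd _ hodd] at hi
    norm_num at hi
  · have hs := (sin_two_mul_pi_div_pos h3).ne'
    have hm : (M i j : ℝ) ≠ 0 := by
      have : M i j ≠ 0 := by omega
      exact_mod_cast this
    have hc : Real.cos (Real.pi / M i j) ≠ 0 := by
      intro hc
      rw [Real.sin_two_mul, hc] at hs
      simp at hs
    have hS1 := S_two_mul_real_cos (2 * (Real.pi / M i j)) (k - 1)
    have hS2 := S_two_mul_real_cos (2 * (Real.pi / M i j)) k
    have hz : (S ℝ ((k : ℤ) - 1)).eval (2 * Real.cos (2 * (Real.pi / M i j))) = 0 :=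
      (mul_eq_zero.1 hj.symm).resolve_right (by simpa using hc)
    rw [hz, add_zero] at hi
    rw [hz, zero_mul] at hS1
    rw [← hi, one_mul] at hS2
    push_cast at hS1 hS2
    rw [sub_add_cancel] at hS1
    rw [add_mul, Real.sin_add, ← hS1, zero_mul, zero_add, one_mul] at hS2
    have hcos : Real.cos (k * (2 * (Real.pi / M i j))) = 1 :=
      mul_right_cancel₀ hs (by linarith)
    obtain ⟨n, hn⟩ := (Real.cos_eq_one_iff _).1 hcos
    have hpi := Real.pi_pos.ne'
    have : (k : ℝ) = n * M i j := by
      field_simp at hn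
      linarith
    have hz : (k : ℤ) = n * M i j := by exact_mod_cast this
    exact Int.natCast_dvd_natCast.1 ⟨n, by rw [hz, mul_comm]⟩

variable {M} {W : Type*} [Group W] (cs : CoxeterSystem M W)

theorem dvd_of_simple_mul_simple_pow {i j : B} (hij : i ≠ j) {k : ℕ}
    (h : (cs.simple i * cs.simple j) ^ k = 1) : M i j ∣ k := by
  apply dvd_of_geomReflection_pow M hij
  have := congrArg (cs.lift ⟨_, geomReflection_isLiftable M⟩) h
  simpa using this

end Geometric

end ZeroHecke

namespace ZeroHecke

/-! ### Inversion parity, strong exchange and alternating suffixes. -/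

section Exchange

open CoxeterSystem

variable {B : Type*} {M : CoxeterMatrix B} {W : Type*} [Group W] (cs : CoxeterSystem M W)

open Classical in
/-- The action of a simple reflection on pairs `(t, ε)`: conjugate `t`, and flip the sign `ε` when
`t` is that simple reflection. -/
noncomputable def signedConj (i : B) : Equiv.Perm (W × ZMod 2) :=
  Function.Involutive.toPerm
    (fun p => (cs.simple i * p.1 * cs.simple i, p.2 + if p.1 = cs.simple i then 1 else 0)) <| by
    rintro ⟨x, e⟩
    have h : cs.simple i * x * cs.simple i = cs.simple i ↔ x = cs.simple i := by
      constructor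
      · intro h
        have := congrArg (fun y => cs.simple i * y * cs.simple i) h
        simpa [mul_assoc] using this
      · rintro rfl
        simp
    have h2 : ∀ c : ZMod 2, c + c = 0 := by decide
    ext1
    · simp [mul_assoc]
    · simp only [h, add_assoc, h2, add_zero]

open Classical in
theorem signedConj_apply (i : B) (x : W) (e : ZMod 2) :
    signedConj cs i (x, e) =
      (cs.simple i * x * cs.simple i, e + if x = cs.simple i then 1 else 0) := rfl

-- The sign records how often `t` meets the reflections `(s_j s_i)^k s_j` with `k < 2n`.
open Classical in
theorem signedConj_mul_pow (i j : B) (n : ℕ) (x : W) (e : ZMod 2) :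
    ((signedConj cs i * signedConj cs j) ^ n) (x, e) =
      ((cs.simple i * cs.simple j) ^ n * x * ((cs.simple i * cs.simple j) ^ n)⁻¹,
        e + ∑ k ∈ Finset.range (2 * n),
          if x = (cs.simple j * cs.simple i) ^ k * cs.simple j then 1 else 0) := by
  have hxq (x : W) (k : ℕ) :
      cs.simple i * (cs.simple j * x * cs.simple j) * cs.simple i =
        (cs.simple j * cs.simple i) ^ k * cs.simple j ↔
      x = (cs.simple j * cs.simple i) ^ (k + 1 + 1) * cs.simple j := by
    have h2 : (cs.simple j * cs.simple i) ^ (k + 1 + 1) * cs.simple j =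
        cs.simple j * cs.simple i * ((cs.simple j * cs.simple i) ^ k * cs.simple j) *
          (cs.simple i * cs.simple j) := by
      rw [pow_succ, pow_succ']
      simp [mul_assoc]
    rw [h2]
    constructor
    · intro h
      rw [← h]
      simp [mul_assoc]
    · rintro rfl
      simp [mul_assoc]
  have hx1 (x : W) : cs.simple j * x * cs.simple j = cs.simple i ↔
      x = (cs.simple j * cs.simple i) ^ 1 * cs.simple j := by
    rw [pow_one]
    constructor
    · intro h
      rw [← h]
      simp [mul_assoc]
    · rintro rfl
      simp [mul_assoc]
  induction n generalizing x e with
  | zero => simp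
  | succ n ih =>
    rw [pow_succ, Equiv.Perm.mul_apply, Equiv.Perm.mul_apply, signedConj_apply, signedConj_apply,
      mul_add, mul_one, Finset.sum_range_succ', Finset.sum_range_succ', ih]
    simp only [hxq, hx1, pow_zero, one_mul, zero_add]
    ext1
    · simp [pow_succ, mul_assoc]
    · simp only
      ring

/-- For `n = m` the reflections indexed by `k` and `k + m` coincide, so every flip occurs twice and
cancels modulo 2. -/
theorem signedConj_isLiftable : M.IsLiftable (signedConj cs) := by
  classical
  intro i j
  ext1 ⟨x, e⟩
  rw [signedConj_mul_pow, cs.simple_mul_simple_pow, two_mul, Finset.sum_range_add]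
  have h2 : ∀ c : ZMod 2, c + c = 0 := by decide
  simp only [pow_add, M.symmetric i j, cs.simple_mul_simple_pow, one_mul, h2]
  simp

/-- The number modulo 2 of times that `t` occurs among the right inversions of a word for `w`. -/
noncomputable def inversionParity (w t : W) : ZMod 2 :=
  (cs.lift ⟨_, signedConj_isLiftable cs⟩ w (t, 0)).2

open Classical in
theorem lift_signedConj_apply (w t : W) (e : ZMod 2) :
    cs.lift ⟨_, signedConj_isLiftable cs⟩ w (t, e) =
      (w * t * w⁻¹, e + inversionParity cs w t) := by
  induction w using cs.simple_induction_left generalizing t e with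
  | one => simp [inversionParity]
  | mul_simple_left w i ih =>
    rw [inversionParity, map_mul, Equiv.Perm.mul_apply, Equiv.Perm.mul_apply, lift_apply_simple,
      ih, ih t 0, signedConj_apply, signedConj_apply]
    simp [mul_assoc, add_assoc]

theorem inversionParity_one (t : W) : inversionParity cs 1 t = 0 := by
  simp [inversionParity]

theorem inversionParity_mul (v w t : W) :
    inversionParity cs (v * w) t =
      inversionParity cs w t + inversionParity cs v (w * t * w⁻¹) := by
  conv_lhs => rw [inversionParity, map_mul, Equiv.Perm.mul_apply, lift_signedConj_apply,
    lift_signedConj_apply, zero_add]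

open Classical in
theorem inversionParity_simple (i : B) (t : W) :
    inversionParity cs (cs.simple i) t = if t = cs.simple i then 1 else 0 := by
  rw [inversionParity, lift_apply_simple, signedConj_apply, zero_add]

/-- Odd parity forces some letter to equal the conjugate of `t` by the suffix after it. Deleting
that letter multiplies the word by `t`. -/
theorem exists_word_of_inversionParity_ne_zero (ω : List B) (t : W)
    (h : inversionParity cs (cs.wordProd ω) t ≠ 0) :
    ∃ ω' : List B, ω'.length < ω.length ∧ cs.wordProd ω' = cs.wordProd ω * t := by
  classical
  induction ω with
  | nil => simp [inversionParity_one] at h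
  | cons i ω ih =>
    rw [wordProd_cons, inversionParity_mul, inversionParity_simple] at h
    by_cases hi : cs.wordProd ω * t * (cs.wordProd ω)⁻¹ = cs.simple i
    · refine ⟨ω, by simp, ?_⟩
      rw [wordProd_cons, ← hi]
      have : cs.wordProd ω * t = cs.simple i * cs.wordProd ω := by rw [← hi]; simp
      rw [hi, mul_assoc, this]
      simp
    · rw [if_neg hi, add_zero] at h
      obtain ⟨ω', h1, h2⟩ := ih h
      exact ⟨i :: ω', by simpa using h1, by rw [wordProd_cons, h2, wordProd_cons, mul_assoc]⟩

/-- The strong exchange property. -/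
theorem length_mul_lt_of_inversionParity_ne_zero {w t : W} (h : inversionParity cs w t ≠ 0) :
    cs.length (w * t) < cs.length w := by
  obtain ⟨ω, hω, rfl⟩ := cs.exists_isReduced w
  obtain ⟨ω', h1, h2⟩ := exists_word_of_inversionParity_ne_zero cs ω t h
  rw [← h2, hω.eq]
  exact (cs.length_wordProd_le ω').trans_lt h1

theorem isRightDescent_iff_inversionParity {w : W} {i : B} :
    cs.IsRightDescent w i ↔ inversionParity cs w (cs.simple i) ≠ 0 := by
  refine ⟨fun h h0 => ?_, length_mul_lt_of_inversionParity_ne_zero cs⟩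
  have h1 : inversionParity cs (w * cs.simple i) (cs.simple i) ≠ 0 := by
    simp [inversionParity_mul, inversionParity_simple, h0]
  have := length_mul_lt_of_inversionParity_ne_zero cs h1
  rw [simple_mul_simple_cancel_right] at this
  exact lt_asymm h this

/-- Left multiplication by `s_i` changes the parity at one reflection only, so a new descent `j`
means `w s_j w⁻¹ = s_i`. -/
theorem simple_mul_eq_mul_simple {w : W} {i j : B} (h : ¬ cs.IsRightDescent w j)
    (h' : cs.IsRightDescent (cs.simple i * w) j) : cs.simple i * w = w * cs.simple j := by
  classical
  rw [isRightDescent_iff_inversionParity] at h h'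
  rw [inversionParity_mul, not_not.1 h, inversionParity_simple, zero_add] at h'
  have : w * cs.simple j * w⁻¹ = cs.simple i := by simpa using h'
  rw [← this]
  simp

theorem wordProd_alternatingWord_succ (i j : B) (k : ℕ) :
    cs.wordProd (alternatingWord i j (k + 1)) =
      cs.wordProd (alternatingWord j i k) * cs.simple j := by
  rw [alternatingWord_succ, wordProd_concat]

theorem exists_pow_of_inversionParity_alternatingWord {i j : B} {k : ℕ} {t : W}
    (h : inversionParity cs (cs.wordProd (alternatingWord j i k)) t ≠ 0) :
    ∃ l < k, t = (cs.simple i * cs.simple j) ^ l * cs.simple i := by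
  classical
  induction k generalizing i j t with
  | zero => simp [alternatingWord, inversionParity_one] at h
  | succ k ih =>
    rw [wordProd_alternatingWord_succ, inversionParity_mul, inversionParity_simple] at h
    by_cases ht : t = cs.simple i
    · exact ⟨0, by omega, by simpa using ht⟩
    · rw [if_neg ht, zero_add] at h
      obtain ⟨l, hl, h⟩ := ih h
      refine ⟨l + 1, by omega, ?_⟩
      have : t = cs.simple i * (cs.simple i * t * (cs.simple i)⁻¹) * cs.simple i := by
        simp [mul_assoc]
      have hp (l : ℕ) : cs.simple i * (cs.simple j * cs.simple i) ^ l =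
          (cs.simple i * cs.simple j) ^ l * cs.simple i := by
        induction l with
        | zero => simp
        | succ l ih => rw [pow_succ, ← mul_assoc, ih, pow_succ]; simp [mul_assoc]
      rw [this, h, ← mul_assoc, hp, pow_succ]
      simp [mul_assoc]

/-- Otherwise `s_j = (s_i s_j)^l s_i` with `l < k`, so `(s_i s_j)^(l+1) = 1`, against the exact
order. -/
theorem inversionParity_alternatingWord_eq_zero {i j : B} (hij : i ≠ j) {k : ℕ}
    (hk : k < M i j ∨ M i j = 0) :
    inversionParity cs (cs.wordProd (alternatingWord j i k)) (cs.simple j) = 0 := by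
  by_contra h
  obtain ⟨l, hl, h⟩ := exists_pow_of_inversionParity_alternatingWord cs h
  have : (cs.simple i * cs.simple j) ^ (l + 1) = 1 := by
    rw [pow_succ, ← mul_assoc, ← h, simple_mul_simple_self]
  have hd := dvd_of_simple_mul_simple_pow cs hij this
  rcases hk with hk | hk
  · have := Nat.le_of_dvd (by omega) hd
    omega
  · rw [hk] at hd
    simp at hd

theorem isReduced_alternatingWord {i j : B} (hij : i ≠ j) {k : ℕ} (hk : k ≤ M i j) :
    cs.IsReduced (alternatingWord i j k) := by
  induction k generalizing i j with
  | zero => simp [alternatingWord, CoxeterSystem.IsReduced]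
  | succ k ih =>
    have h := inversionParity_alternatingWord_eq_zero cs hij (Or.inl (Nat.lt_of_succ_le hk))
    have h1 := ih hij.symm (by rw [M.symmetric]; omega)
    have h2 : ¬ cs.IsRightDescent (cs.wordProd (alternatingWord j i k)) j := by
      rw [isRightDescent_iff_inversionParity, h]
      simp
    rw [CoxeterSystem.IsReduced, wordProd_alternatingWord_succ, cs.not_isRightDescent_iff.1 h2,
      h1.eq, length_alternatingWord, length_alternatingWord]

/-- If `i` and `j` are right descents of `w` then `w` has a reduced word that ends with any
alternating word of length at most `m_{ij}`. -/
theorem exists_eq_mul_alternatingWord {w : W} {i j : B} (hij : i ≠ j)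
    (hi : cs.IsRightDescent w i) (hj : cs.IsRightDescent w j) {k : ℕ}
    (hk : k ≤ M i j ∨ M i j = 0) :
    ∃ u, w = u * cs.wordProd (alternatingWord i j k) ∧ cs.length w = cs.length u + k := by
  induction k generalizing i j with
  | zero => exact ⟨w, by simp [alternatingWord], rfl⟩
  | succ k ih =>
    obtain ⟨u, h1, h2⟩ := ih hij.symm hj hi (by rw [M.symmetric]; omega)
    have hz := inversionParity_alternatingWord_eq_zero cs (i := i) (j := j) hij (k := k) (by omega)
    set v := cs.wordProd (alternatingWord j i k) with hv
    -- As `s_j` is an inversion of `u v` but not of `v`, its conjugate `v s_j v⁻¹` is one of `u`. It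
    -- can be removed from `u`, and the length bound then becomes an equality.
    rw [isRightDescent_iff_inversionParity, h1, inversionParity_mul, hz, zero_add] at hj
    have hlt := length_mul_lt_of_inversionParity_ne_zero cs hj
    refine ⟨u * (v * cs.simple j * v⁻¹), ?_, ?_⟩
    · rw [wordProd_alternatingWord_succ, ← hv, h1]
      simp [mul_assoc]
    · have h3 : w = u * (v * cs.simple j * v⁻¹) * cs.wordProd (alternatingWord i j (k + 1)) := by
        rw [wordProd_alternatingWord_succ, ← hv, h1]
        simp [mul_assoc]
      have h4 := cs.length_mul_le (u * (v * cs.simple j * v⁻¹))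
        (cs.wordProd (alternatingWord i j (k + 1)))
      have h5 := cs.length_wordProd_le (alternatingWord i j (k + 1))
      rw [length_alternatingWord] at h5
      rw [← h3] at h4
      omega

end Exchange

end ZeroHecke

namespace ZeroHecke

/-! ### Matsumoto's theorem, supports of reduced words and longest elements. -/

section Matsumoto

open CoxeterSystem

variable {B : Type*} {M : CoxeterMatrix B} {W : Type*} [Group W] (cs : CoxeterSystem M W)

theorem coxeterMatrix_ne_zero_of_isRightDescent {w : W} {i j : B} (hij : i ≠ j)
    (hi : cs.IsRightDescent w i) (hj : cs.IsRightDescent w j) : M i j ≠ 0 := by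
  intro h
  obtain ⟨u, -, hu⟩ := exists_eq_mul_alternatingWord cs hij hi hj (k := cs.length w + 1) (Or.inr h)
  omega

theorem isRightDescent_of_isReduced_concat {ω : List B} {i : B} (h : cs.IsReduced (ω ++ [i])) :
    cs.IsRightDescent (cs.wordProd (ω ++ [i])) i := by
  rw [IsRightDescent, h.eq, wordProd_append, wordProd_singleton, simple_mul_simple_cancel_right]
  have := cs.length_wordProd_le ω
  simp only [List.length_append, List.length_singleton]
  omega

/-- Matsumoto's theorem: if the values of `f` satisfy the braid relations, then the product of the
values of `f` along a reduced word depends only on the group element. -/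
theorem prod_map_eq_of_isReduced {G : Type*} [Monoid G] {f : B → G}
    (hf : ∀ i j, i ≠ j → ((braidWord M i j).map f).prod = ((braidWord M j i).map f).prod)
    {ω ω' : List B} (h : cs.IsReduced ω) (h' : cs.IsReduced ω')
    (hw : cs.wordProd ω = cs.wordProd ω') : (ω.map f).prod = (ω'.map f).prod := by
  obtain ⟨n, hn⟩ : ∃ n, ω.length = n := ⟨_, rfl⟩
  induction n generalizing ω ω' with
  | zero =>
    have hn' : ω'.length = 0 := by rw [← h'.eq, ← hw, h.eq, hn]
    rw [List.length_eq_zero_iff.1 hn, List.length_eq_zero_iff.1 hn']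
  | succ n ih =>
    have hstep {μ ν : List B} {i : B} (hμ : cs.IsReduced (μ ++ [i])) (hν : cs.IsReduced (ν ++ [i]))
        (hw : cs.wordProd (μ ++ [i]) = cs.wordProd (ν ++ [i])) (hl : (μ ++ [i]).length = n + 1) :
        ((μ ++ [i]).map f).prod = ((ν ++ [i]).map f).prod := by
      have h1 : cs.IsReduced μ := by simpa using hμ.take μ.length
      have h2 : cs.IsReduced ν := by simpa using hν.take ν.length
      have h3 : cs.wordProd μ = cs.wordProd ν := by
        simpa [wordProd_append] using hw
      simp [ih h1 h2 h3 (by simpa using hl)]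
    have hn' : ω'.length = n + 1 := by rw [← h'.eq, ← hw, h.eq, hn]
    obtain ⟨μ, i, rfl⟩ : ∃ μ i, ω = μ ++ [i] :=
      (List.eq_nil_or_concat' ω).resolve_left (by rintro rfl; simp at hn)
    obtain ⟨ν, j, rfl⟩ : ∃ ν j, ω' = ν ++ [j] :=
      (List.eq_nil_or_concat' ω').resolve_left (by rintro rfl; simp at hn')
    by_cases hij : i = j
    · subst hij
      exact hstep h h' hw hn
    have hi := isRightDescent_of_isReduced_concat cs h
    have hj := isRightDescent_of_isReduced_concat cs h'
    rw [← hw] at hj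
    have hm := coxeterMatrix_ne_zero_of_isRightDescent cs hij hi hj
    -- With different last letters, `w` ends in the full alternating word in `i` and `j`. This
    -- yields two reduced words of `w`, ending in `i` and in `j`, that differ by one braid move.
    -- Each shares its last letter with one of the given words.
    obtain ⟨u, hu, hl⟩ := exists_eq_mul_alternatingWord cs hij hi hj (Or.inl le_rfl)
    obtain ⟨m, hm⟩ := Nat.exists_eq_succ_of_ne_zero hm
    obtain ⟨ξ, hξ, rfl⟩ := cs.exists_isReduced u
    have e1 : braidWord M i j = alternatingWord j i m ++ [j] := by
      rw [braidWord, hm, alternatingWord_succ, List.concat_eq_append]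
    have e2 : braidWord M j i = alternatingWord i j m ++ [i] := by
      rw [braidWord, M.symmetric, hm, alternatingWord_succ, List.concat_eq_append]
    have hb := hf i j hij
    have hbw := cs.wordProd_braidWord_eq i j
    rw [h.eq, hξ.eq, hn, hm] at hl
    have hu' : cs.wordProd (μ ++ [i]) = cs.wordProd ξ * cs.wordProd (braidWord M i j) := hu
    rw [e1] at hb hbw hu'
    rw [e2] at hb hbw
    have hA : cs.wordProd ((ξ ++ alternatingWord j i m) ++ [j]) = cs.wordProd (μ ++ [i]) := by
      rw [hu', List.append_assoc, wordProd_append]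
    have hB : cs.wordProd ((ξ ++ alternatingWord i j m) ++ [i]) = cs.wordProd (μ ++ [i]) := by
      rw [hu', hbw, List.append_assoc, wordProd_append]
    have rA : cs.IsReduced ((ξ ++ alternatingWord j i m) ++ [j]) := by
      rw [CoxeterSystem.IsReduced, hA, h.eq, hn]
      simp
      omega
    have rB : cs.IsReduced ((ξ ++ alternatingWord i j m) ++ [i]) := by
      rw [CoxeterSystem.IsReduced, hB, h.eq, hn]
      simp
      omega
    rw [hstep h rB hB.symm hn, hstep h' rA (hw.symm.trans hA.symm) hn', List.append_assoc,
      List.append_assoc, List.map_append, List.prod_append, ← hb, ← List.prod_append,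
      ← List.map_append]

theorem reducedWord_isReduced (w : W) : cs.IsReduced (reducedWord cs w) :=
  (cs.exists_isReduced w).choose_spec.1

theorem wordProd_reducedWord (w : W) : cs.wordProd (reducedWord cs w) = w :=
  (cs.exists_isReduced w).choose_spec.2.symm

theorem prod_map_reducedWord {G : Type*} [Monoid G] {f : B → G}
    (hf : ∀ i j, i ≠ j → ((braidWord M i j).map f).prod = ((braidWord M j i).map f).prod)
    {ω : List B} (h : cs.IsReduced ω) :
    ((reducedWord cs (cs.wordProd ω)).map f).prod = (ω.map f).prod :=
  prod_map_eq_of_isReduced cs hf (reducedWord_isReduced cs _) h (wordProd_reducedWord cs _)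

theorem isReduced_append_singleton {ω : List B} (hω : cs.IsReduced ω) {i : B}
    (h : ¬ cs.IsRightDescent (cs.wordProd ω) i) : cs.IsReduced (ω ++ [i]) := by
  rw [CoxeterSystem.IsReduced, wordProd_append, wordProd_singleton, cs.not_isRightDescent_iff.1 h,
    hω.eq]
  simp

theorem isReduced_cons {ω : List B} (hω : cs.IsReduced ω) {i : B}
    (h : ¬ cs.IsLeftDescent (cs.wordProd ω) i) : cs.IsReduced (i :: ω) := by
  rw [CoxeterSystem.IsReduced, wordProd_cons, cs.not_isLeftDescent_iff.1 h, hω.eq]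
  simp

theorem prod_map_reducedWord_mul_simple {G : Type*} [Monoid G] {f : B → G}
    (hf : ∀ i j, i ≠ j → ((braidWord M i j).map f).prod = ((braidWord M j i).map f).prod)
    {w : W} {i : B} (h : ¬ cs.IsRightDescent w i) :
    ((reducedWord cs (w * cs.simple i)).map f).prod = ((reducedWord cs w).map f).prod * f i := by
  have hr := isReduced_append_singleton cs (reducedWord_isReduced cs w)
    (by rwa [wordProd_reducedWord cs w])
  have := prod_map_reducedWord cs hf hr
  rw [wordProd_append, wordProd_reducedWord, wordProd_singleton] at this
  simpa using this

theorem prod_map_reducedWord_simple_mul {G : Type*} [Monoid G] {f : B → G}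
    (hf : ∀ i j, i ≠ j → ((braidWord M i j).map f).prod = ((braidWord M j i).map f).prod)
    {w : W} {i : B} (h : ¬ cs.IsLeftDescent w i) :
    ((reducedWord cs (cs.simple i * w)).map f).prod = f i * ((reducedWord cs w).map f).prod := by
  have hr := isReduced_cons cs (reducedWord_isReduced cs w)
    (by rwa [wordProd_reducedWord cs w])
  have := prod_map_reducedWord cs hf hr
  rw [wordProd_cons, wordProd_reducedWord] at this
  simpa using this

theorem mem_alternatingWord_iff {i j : B} {k : ℕ} (hk : 2 ≤ k) (x : B) :
    x ∈ alternatingWord i j k ↔ x = i ∨ x = j := by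
  induction k, hk using Nat.le_induction generalizing i j with
  | base => simp [alternatingWord]
  | succ k hk ih => simp [alternatingWord_succ, ih]; tauto

/-- Insertion of an element, in the monoid of maps from `Set B` to itself. -/
def insertEnd (i : B) : Function.End (Set B) := fun T => insert i T

theorem prod_map_insertEnd (ω : List B) (T : Set B) :
    (ω.map insertEnd).prod T = {x | x ∈ ω} ∪ T := by
  induction ω with
  | nil =>
    ext x
    simp only [List.map_nil, List.prod_nil, List.not_mem_nil, Set.mem_union, Set.mem_ofPred_eq,
      false_or]
    rfl
  | cons i ω ih =>
    rw [List.map_cons, List.prod_cons]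
    change insert i ((ω.map insertEnd).prod T) = _
    rw [ih]
    ext x
    simp [or_assoc]

/-- Insertions into a set satisfy the braid relations, so Matsumoto's theorem in the monoid of
self-maps of `Set B` shows that the support is well defined. -/
theorem mem_reducedWord_iff {ω : List B} (h : cs.IsReduced ω) (x : B) :
    x ∈ reducedWord cs (cs.wordProd ω) ↔ x ∈ ω := by
  have key := prod_map_reducedWord cs (f := insertEnd) ?_ h
  · have := congrFun key ∅
    rw [prod_map_insertEnd, prod_map_insertEnd, Set.union_empty, Set.union_empty] at this
    exact Set.ext_iff.1 this x
  · intro i j hij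
    funext T
    rw [prod_map_insertEnd, prod_map_insertEnd, braidWord, braidWord, M.symmetric j i]
    by_cases h0 : M i j = 0
    · simp [h0, alternatingWord]
    · congr 1
      ext x
      simp only [Set.mem_ofPred_eq, mem_alternatingWord_iff (two_le_coxeterMatrix M hij h0)]
      exact or_comm

theorem mem_reducedWord_mul_simple {w : W} {i x : B}
    (hx : x ∈ reducedWord cs (w * cs.simple i)) : x = i ∨ x ∈ reducedWord cs w := by
  by_cases h : cs.IsRightDescent w i
  · have h' := cs.isRightDescent_iff_not_isRightDescent_mul.1 h
    have hr := isReduced_append_singleton cs (reducedWord_isReduced cs (w * cs.simple i)) (i := i)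
      (by rwa [wordProd_reducedWord])
    have := mem_reducedWord_iff cs hr x
    rw [wordProd_append, wordProd_reducedWord, wordProd_singleton,
      simple_mul_simple_cancel_right] at this
    exact Or.inr (this.2 (by simp [hx]))
  · have hr := isReduced_append_singleton cs (reducedWord_isReduced cs w) (i := i)
      (by rwa [wordProd_reducedWord])
    have := mem_reducedWord_iff cs hr x
    rw [wordProd_append, wordProd_reducedWord, wordProd_singleton] at this
    simpa [or_comm] using this.1 hx

/-- The letters of a reduced word for an element of `W_I` belong to `I`. -/
theorem mem_of_mem_reducedWord {I : Set B} {w : W} (hw : w ∈ parabolicSubgroup cs I) {i : B}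
    (hi : i ∈ reducedWord cs w) : i ∈ I := by
  have hstep (w : W) (y : W) (hy : y ∈ cs.simple '' I) (h : ∀ i ∈ reducedWord cs w, i ∈ I) :
      ∀ i ∈ reducedWord cs (w * y), i ∈ I := by
    obtain ⟨j, hj, rfl⟩ := hy
    intro i hi
    rcases mem_reducedWord_mul_simple cs hi with rfl | hi
    exacts [hj, h i hi]
  revert i
  change ∀ i ∈ reducedWord cs w, i ∈ I
  induction hw using Subgroup.closure_induction_right with
  | one =>
    have := (reducedWord_isReduced cs (1 : W)).eq
    rw [wordProd_reducedWord, length_one, eq_comm, List.length_eq_zero_iff] at this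
    simp [this]
  | mul_right w _ y hy ih => exact hstep w y hy ih
  | mul_inv_cancel w _ y hy ih =>
    refine hstep w y⁻¹ ?_ ih
    obtain ⟨j, hj, rfl⟩ := hy
    exact ⟨j, hj, (cs.inv_simple j).symm⟩

theorem simple_mem_parabolicSubgroup {I : Set B} {i : B} (hi : i ∈ I) :
    cs.simple i ∈ parabolicSubgroup cs I :=
  Subgroup.subset_closure ⟨i, hi, rfl⟩

variable [Finite W]

theorem longest_mem (I : Set B) : longest cs I ∈ parabolicSubgroup cs I :=
  (exists_longest cs I).choose_spec.1

theorem length_le_length_longest {I : Set B} {v : W} (hv : v ∈ parabolicSubgroup cs I) :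
    cs.length v ≤ cs.length (longest cs I) :=
  (exists_longest cs I).choose_spec.2 v hv

theorem isRightDescent_longest {I : Set B} {i : B} (hi : i ∈ I) :
    cs.IsRightDescent (longest cs I) i := by
  have := length_le_length_longest cs
    (mul_mem (longest_mem cs I) (simple_mem_parabolicSubgroup cs hi))
  exact lt_of_le_of_ne this (cs.length_mul_simple_ne _ i)

theorem isLeftDescent_longest {I : Set B} {i : B} (hi : i ∈ I) :
    cs.IsLeftDescent (longest cs I) i := by
  have := length_le_length_longest cs
    (mul_mem (simple_mem_parabolicSubgroup cs hi) (longest_mem cs I))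
  exact lt_of_le_of_ne this (cs.length_simple_mul_ne _ i)

theorem mem_of_mem_reducedWord_longest {I : Set B} {i : B}
    (hi : i ∈ reducedWord cs (longest cs I)) : i ∈ I :=
  mem_of_mem_reducedWord cs (longest_mem cs I) hi

end Matsumoto

end ZeroHecke

namespace ZeroHecke

open CoxeterSystem

/-! ### Braid relations pass from idempotents `f` to `f - 1`. -/

section Idempotent

/-- The two expansions share every term `r` except the top ones. The identities for `r * f i` and `r
* f j` say that each product of factors `f - 1` is annihilated on the right by `f` of its last
letter; they drive the induction. -/
theorem exists_prod_map_alternatingWord_sub_one {A B : Type*} [Ring A] {f : B → A} {i j : B}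
    (hi : f i * f i = f i) (hj : f j * f j = f j) (k : ℕ) :
    ∃ r : A, r * f i = -((alternatingWord j i (k + 1)).map f).prod ∧
      r * f j = -((alternatingWord i j (k + 1)).map f).prod ∧
      ((alternatingWord j i (k + 1)).map fun s => f s - 1).prod =
        ((alternatingWord j i (k + 1)).map f).prod + r ∧
      ((alternatingWord i j (k + 1)).map fun s => f s - 1).prod =
        ((alternatingWord i j (k + 1)).map f).prod + r := by
  induction k with
  | zero => exact ⟨-1, by simp [alternatingWord, sub_eq_add_neg]⟩
  | succ k ih =>
    obtain ⟨r, h1, h2, h3, h4⟩ := ih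
    set a := ((alternatingWord j i (k + 1)).map f).prod with ha
    set b := ((alternatingWord i j (k + 1)).map f).prod with hb
    have ha' : a * f i = a := by
      rw [ha, alternatingWord_succ, List.concat_eq_append, List.map_append, List.prod_append]
      simp [mul_assoc, hi]
    have hb' : b * f j = b := by
      rw [hb, alternatingWord_succ, List.concat_eq_append, List.map_append, List.prod_append]
      simp [mul_assoc, hj]
    have hs {g : B → A} (i j : B) : ((alternatingWord i j (k + 1 + 1)).map g).prod =
        ((alternatingWord j i (k + 1)).map g).prod * g j := by
      rw [alternatingWord_succ, List.concat_eq_append, List.map_append, List.prod_append]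
      simp
    refine ⟨-r - a - b, ?_, ?_, ?_, ?_⟩
    · rw [hs, ← hb, sub_mul, sub_mul, neg_mul, h1, ha']
      abel
    · rw [hs, ← ha, sub_mul, sub_mul, neg_mul, h2, hb']
      abel
    · rw [hs, hs, h4, ← hb, mul_sub, add_mul, h1, mul_one]
      abel
    · rw [hs, hs, h3, ← ha, mul_sub, add_mul, h2, mul_one]
      abel

theorem prod_map_alternatingWord_sub_one_eq {A B : Type*} [Ring A] {f : B → A} {i j : B}
    (hi : f i * f i = f i) (hj : f j * f j = f j) (k : ℕ)
    (h : ((alternatingWord i j k).map f).prod = ((alternatingWord j i k).map f).prod) :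
    ((alternatingWord i j k).map fun s => f s - 1).prod =
      ((alternatingWord j i k).map fun s => f s - 1).prod := by
  cases k with
  | zero => rfl
  | succ k =>
    obtain ⟨r, -, -, h3, h4⟩ := exists_prod_map_alternatingWord_sub_one hi hj k
    rw [h3, h4, h]

end Idempotent

/-! ### Relations among the `π_s` and the `π̄_s`. -/

section Relations

variable (F : Type*) [Field F] {B : Type*} {M : CoxeterMatrix B}

theorem gen_mul_self (i : B) : gen F M i * gen F M i = gen F M i := by
  have := RingQuot.mkAlgHom_rel F (Rel.quadratic (F := F) (M := M) i)
  rw [map_mul] at this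
  exact this

theorem prod_map_mk (ω : List B) :
    mk F M (ω.map (FreeAlgebra.ι F)).prod = (ω.map (gen F M)).prod := by
  rw [map_list_prod, List.map_map]
  rfl

theorem gen_braid (i j : B) (h : i ≠ j) :
    ((braidWord M i j).map (gen F M)).prod = ((braidWord M j i).map (gen F M)).prod := by
  rw [← prod_map_mk, ← prod_map_mk]
  exact RingQuot.mkAlgHom_rel F (Rel.braid i j h)

variable (M) in
/-- The element `π̄_s = π_s - 1`. -/
noncomputable def genBar (i : B) : Hecke F M := gen F M i - 1

theorem genBar_mul_gen (i : B) : genBar F M i * gen F M i = 0 := by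
  rw [genBar, sub_mul, gen_mul_self, one_mul, sub_self]

theorem genBar_mul_self (i : B) : genBar F M i * genBar F M i = -genBar F M i := by
  conv_lhs => rw [genBar, mul_sub, ← genBar, genBar_mul_gen, mul_one, zero_sub]

theorem gen_eq (i : B) : gen F M i = genBar F M i + 1 := by simp [genBar]

theorem genBar_braid (i j : B) (h : i ≠ j) :
    ((braidWord M i j).map (genBar F M)).prod = ((braidWord M j i).map (genBar F M)).prod := by
  have := prod_map_alternatingWord_sub_one_eq (gen_mul_self F (M := M) i) (gen_mul_self F j) (M i j)
    (by simpa only [braidWord, M.symmetric j i] using gen_braid F (M := M) i j h)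
  rw [braidWord, braidWord, M.symmetric j i]
  exact this

theorem mk_surjective : Function.Surjective (mk F M) := RingQuot.mkAlgHom_surjective F _

/-- A subspace stable under right multiplication by the `π̄_s` is a right ideal. -/
theorem mul_mem_of_mul_genBar_mem (S : Submodule F (Hecke F M))
    (hS : ∀ x ∈ S, ∀ i, x * genBar F M i ∈ S) {x : Hecke F M} (hx : x ∈ S) (a : Hecke F M) :
    x * a ∈ S := by
  obtain ⟨a, rfl⟩ := mk_surjective F a
  induction a using FreeAlgebra.induction generalizing x with
  | grade0 r => rw [AlgHom.commutes, ← Algebra.commutes, ← Algebra.smul_def]; exact S.smul_mem r hx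
  | grade1 i =>
    change x * gen F M i ∈ S
    rw [gen_eq, mul_add, mul_one]
    exact S.add_mem (hS x hx i) hx
  | mul a b iha ihb => rw [map_mul, ← mul_assoc]; exact ihb (iha hx)
  | add a b iha ihb => rw [map_add, mul_add]; exact S.add_mem (iha hx) (ihb hx)

end Relations

/-! ### The Demazure action of `H_W(0)` on `F[W]`. -/

section Demazure

section Linearize

variable {W : Type*} (F : Type*) [Field F]

/-- The linear extension of a self-map of a set to the free module, as a monoid homomorphism. -/
noncomputable def linearizeEnd : Function.End W →* Module.End F (W →₀ F) where
  toFun f := Finsupp.lmapDomain F F f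
  map_one' := Finsupp.lmapDomain_id F F
  map_mul' f g := Finsupp.lmapDomain_comp F F g f

theorem linearizeEnd_single (f : Function.End W) (w : W) :
    linearizeEnd F f (Finsupp.single w 1) = Finsupp.single (f w) 1 := Finsupp.mapDomain_single

end Linearize

variable {B : Type*} {M : CoxeterMatrix B} {W : Type*} [Group W] (cs : CoxeterSystem M W)

open Classical in
/-- Left Demazure multiplication by a simple reflection. -/
noncomputable def demazureLeft (i : B) : Function.End W :=
  fun w => if cs.IsLeftDescent w i then w else cs.simple i * w

open Classical in
/-- Right Demazure multiplication by a simple reflection. -/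
noncomputable def demazureRight (i : B) : Function.End W :=
  fun w => if cs.IsRightDescent w i then w else w * cs.simple i

theorem demazureLeft_of_isLeftDescent {i : B} {w : W} (h : cs.IsLeftDescent w i) :
    demazureLeft cs i w = w := if_pos h

theorem demazureLeft_of_not_isLeftDescent {i : B} {w : W} (h : ¬ cs.IsLeftDescent w i) :
    demazureLeft cs i w = cs.simple i * w := if_neg h

theorem demazureRight_of_isRightDescent {i : B} {w : W} (h : cs.IsRightDescent w i) :
    demazureRight cs i w = w := if_pos h

theorem demazureRight_of_not_isRightDescent {i : B} {w : W} (h : ¬ cs.IsRightDescent w i) :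
    demazureRight cs i w = w * cs.simple i := if_neg h

/-- The delicate case has neither descent in `w` but `j` a descent of `s_i w`: then `s_i w = w s_j`
by exchange, and both sides equal it. -/
theorem demazureLeft_demazureRight (i j : B) (w : W) :
    demazureLeft cs i (demazureRight cs j w) = demazureRight cs j (demazureLeft cs i w) := by
  have ha := mul_assoc (cs.simple i) w (cs.simple j)
  have h1 := cs.length_mul_simple w j
  have h2 := cs.length_simple_mul w i
  have h3 := cs.length_mul_simple (cs.simple i * w) j
  have h4 := cs.length_simple_mul (w * cs.simple j) i
  rw [← ha] at h4
  by_cases hl : cs.IsLeftDescent w i <;> by_cases hr : cs.IsRightDescent w j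
  · rw [demazureRight_of_isRightDescent cs hr, demazureLeft_of_isLeftDescent cs hl,
      demazureRight_of_isRightDescent cs hr]
  · rw [demazureRight_of_not_isRightDescent cs hr, demazureLeft_of_isLeftDescent cs hl,
      demazureRight_of_not_isRightDescent cs hr, demazureLeft_of_isLeftDescent cs]
    rw [IsLeftDescent, ← ha]
    rw [IsLeftDescent] at hl
    rw [IsRightDescent] at hr
    omega
  · rw [demazureRight_of_isRightDescent cs hr, demazureLeft_of_not_isLeftDescent cs hl,
      demazureRight_of_isRightDescent cs]
    rw [IsLeftDescent] at hl
    rw [IsRightDescent] at hr ⊢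
    omega
  · rw [demazureRight_of_not_isRightDescent cs hr, demazureLeft_of_not_isLeftDescent cs hl]
    by_cases h : cs.IsRightDescent (cs.simple i * w) j
    · rw [demazureRight_of_isRightDescent cs h, demazureLeft_of_isLeftDescent cs,
        simple_mul_eq_mul_simple cs hr h]
      rw [IsLeftDescent, ← ha]
      rw [IsLeftDescent] at hl
      rw [IsRightDescent] at hr h
      omega
    · rw [demazureRight_of_not_isRightDescent cs h, demazureLeft_of_not_isLeftDescent cs, ha]
      rw [IsLeftDescent, ← ha]
      rw [IsLeftDescent] at hl
      rw [IsRightDescent] at hr h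
      omega

theorem demazureLeft_prod_cons (i : B) (ω : List B) (w : W) :
    ((i :: ω).map (demazureLeft cs)).prod w =
      demazureLeft cs i ((ω.map (demazureLeft cs)).prod w) := by
  rw [List.map_cons, List.prod_cons]
  rfl

theorem demazureLeft_prod_demazureRight (ω : List B) (j : B) (w : W) :
    (ω.map (demazureLeft cs)).prod (demazureRight cs j w) =
      demazureRight cs j ((ω.map (demazureLeft cs)).prod w) := by
  induction ω with
  | nil => rfl
  | cons i ω ih =>
    rw [demazureLeft_prod_cons, demazureLeft_prod_cons, ih, demazureLeft_demazureRight]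

theorem demazureLeft_prod_one {ω : List B} (h : cs.IsReduced ω) :
    (ω.map (demazureLeft cs)).prod 1 = cs.wordProd ω := by
  induction ω with
  | nil => simp; rfl
  | cons i ω ih =>
    have h' : cs.IsReduced ω := h.drop 1
    rw [demazureLeft_prod_cons, ih h', demazureLeft_of_not_isLeftDescent cs, wordProd_cons]
    rw [IsLeftDescent, ← wordProd_cons, h.eq, h'.eq]
    simp

/-- Left operators commute with right ones, and every `w` is reached from `1` by right operators. At
`1` both sides give the same alternating element, whose two words are reduced. -/
theorem demazureLeft_braid (i j : B) (hij : i ≠ j) :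
    ((braidWord M i j).map (demazureLeft cs)).prod =
      ((braidWord M j i).map (demazureLeft cs)).prod := by
  funext w
  obtain ⟨n, hn⟩ : ∃ n, cs.length w = n := ⟨_, rfl⟩
  induction n generalizing w with
  | zero =>
    rw [cs.length_eq_zero_iff.1 hn, demazureLeft_prod_one cs (isReduced_alternatingWord cs hij le_rfl),
      demazureLeft_prod_one cs (isReduced_alternatingWord cs hij.symm le_rfl), wordProd_braidWord_eq]
  | succ n ih =>
    obtain ⟨k, hk⟩ := cs.exists_rightDescent_of_ne_one (w := w) (by rintro rfl; simp at hn)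
    have hk' := cs.isRightDescent_iff_not_isRightDescent_mul.1 hk
    have h1 : demazureRight cs k (w * cs.simple k) = w := by
      rw [demazureRight_of_not_isRightDescent cs hk', simple_mul_simple_cancel_right]
    have h2 := cs.isRightDescent_iff.1 hk
    rw [← h1, demazureLeft_prod_demazureRight, demazureLeft_prod_demazureRight, ih _ (by omega)]

theorem demazureLeft_mul_self (i : B) :
    demazureLeft cs i * demazureLeft cs i = demazureLeft cs i := by
  funext w
  change demazureLeft cs i (demazureLeft cs i w) = _
  by_cases h : cs.IsLeftDescent w i
  · rw [demazureLeft_of_isLeftDescent cs h, demazureLeft_of_isLeftDescent cs h]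
  · rw [demazureLeft_of_not_isLeftDescent cs h, demazureLeft_of_isLeftDescent]
    rw [IsLeftDescent, simple_mul_simple_cancel_left]
    exact lt_of_le_of_ne (not_lt.1 h) (cs.length_simple_mul_ne w i).symm

variable (F : Type*) [Field F]

/-- The regular representation of the 0-Hecke algebra. -/
noncomputable def regularRep : Hecke F M →ₐ[F] Module.End F (W →₀ F) :=
  RingQuot.liftAlgHom F ⟨FreeAlgebra.lift F fun i => linearizeEnd F (demazureLeft cs i), by
    have key (ω : List B) : FreeAlgebra.lift F (fun i => linearizeEnd F (demazureLeft cs i))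
        (ω.map (FreeAlgebra.ι F)).prod = linearizeEnd F (ω.map (demazureLeft cs)).prod := by
      rw [map_list_prod, map_list_prod, List.map_map, List.map_map]
      congr 2
      funext i
      simp
    rintro _ _ (i | ⟨i, j, h⟩)
    · rw [map_mul, FreeAlgebra.lift_ι_apply, ← map_mul, demazureLeft_mul_self]
    · rw [key, key, demazureLeft_braid cs i j h]⟩

theorem regularRep_gen (i : B) :
    regularRep cs F (gen F M i) = linearizeEnd F (demazureLeft cs i) := by
  have : regularRep cs F (gen F M i) = FreeAlgebra.lift F
      (fun i => linearizeEnd F (demazureLeft cs i)) (FreeAlgebra.ι F i) :=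
    RingQuot.liftAlgHom_mkAlgHom_apply ..
  rw [this, FreeAlgebra.lift_ι_apply]

theorem regularRep_piElt (w : W) :
    regularRep cs F (piElt cs F w) (Finsupp.single 1 1) = Finsupp.single w 1 := by
  have : regularRep cs F (piElt cs F w) =
      linearizeEnd F ((reducedWord cs w).map (demazureLeft cs)).prod := by
    rw [piElt, map_list_prod, map_list_prod, List.map_map, List.map_map]
    congr 2
    funext i
    exact regularRep_gen cs F i
  rw [this, linearizeEnd_single, demazureLeft_prod_one cs (reducedWord_isReduced cs w),
    wordProd_reducedWord]

end Demazure

/-! ### The basis `π̄_w`. -/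

section Basis

variable {B : Type*} {M : CoxeterMatrix B} {W : Type*} [Group W] (cs : CoxeterSystem M W)
variable (F : Type*) [Field F]

theorem gen_mul_piElt {w : W} {i : B} (h : cs.IsLeftDescent w i) :
    gen F M i * piElt cs F w = piElt cs F w := by
  have h' := cs.isLeftDescent_iff_not_isLeftDescent_mul.1 h
  have := prod_map_reducedWord_simple_mul cs (gen_braid F) h'
  rw [simple_mul_simple_cancel_left] at this
  rw [piElt, this, ← mul_assoc, gen_mul_self]

theorem piBarElt_mul_genBar_of_not_isRightDescent {w : W} {i : B} (h : ¬ cs.IsRightDescent w i) :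
    piBarElt cs F w * genBar F M i = piBarElt cs F (w * cs.simple i) :=
  (prod_map_reducedWord_mul_simple cs (genBar_braid F) h).symm

theorem piBarElt_mul_genBar_of_isRightDescent {w : W} {i : B} (h : cs.IsRightDescent w i) :
    piBarElt cs F w * genBar F M i = -piBarElt cs F w := by
  have h' := cs.isRightDescent_iff_not_isRightDescent_mul.1 h
  have := piBarElt_mul_genBar_of_not_isRightDescent cs F h'
  rw [simple_mul_simple_cancel_right] at this
  rw [← this, mul_assoc, genBar_mul_self, mul_neg]

theorem piBarElt_one : piBarElt cs F 1 = 1 := by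
  have := (reducedWord_isReduced cs (1 : W)).eq
  rw [wordProd_reducedWord, length_one, eq_comm, List.length_eq_zero_iff] at this
  rw [piBarElt, this]
  rfl

theorem span_piBarElt : Submodule.span F (Set.range (piBarElt cs F)) = ⊤ := by
  rw [eq_top_iff]
  intro a _
  have h1 : (1 : Hecke F M) ∈ Submodule.span F (Set.range (piBarElt cs F)) :=
    Submodule.subset_span ⟨1, piBarElt_one cs F⟩
  rw [← one_mul a]
  refine mul_mem_of_mul_genBar_mem F _ ?_ h1 a
  intro x hx i
  induction hx using Submodule.span_induction with
  | mem x hx =>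
    obtain ⟨w, rfl⟩ := hx
    by_cases h : cs.IsRightDescent w i
    · rw [piBarElt_mul_genBar_of_isRightDescent cs F h]
      exact Submodule.neg_mem _ (Submodule.subset_span ⟨w, rfl⟩)
    · rw [piBarElt_mul_genBar_of_not_isRightDescent cs F h]
      exact Submodule.subset_span ⟨_, rfl⟩
  | zero => simp
  | add x y _ _ hx hy => rw [add_mul]; exact Submodule.add_mem _ hx hy
  | smul c x _ hx => rw [smul_mul_assoc]; exact Submodule.smul_mem _ c hx

variable [Finite W]

theorem finite_hecke (cs : CoxeterSystem M W) : Module.Finite F (Hecke F M) :=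
  ⟨⟨(Set.finite_range (piBarElt cs F)).toFinset, by simpa using span_piBarElt cs F⟩⟩

/-- Acting on the basis vector at `1` maps `H_W(0)` onto `F[W]`, since `π_w` sends it to the one at
`w`. -/
theorem card_le_finrank_hecke (cs : CoxeterSystem M W) :
    Nat.card W ≤ Module.finrank F (Hecke F M) := by
  have := finite_hecke F cs
  cases nonempty_fintype W
  have hf : Function.Surjective
      ((LinearMap.applyₗ (Finsupp.single (1 : W) (1 : F))).comp (regularRep cs F).toLinearMap) := by
    intro v
    induction v using Finsupp.induction_linear with
    | zero => exact ⟨0, map_zero _⟩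
    | add u v hu hv =>
      obtain ⟨x, rfl⟩ := hu
      obtain ⟨y, rfl⟩ := hv
      exact ⟨x + y, map_add _ x y⟩
    | single w c =>
      refine ⟨c • piElt cs F w, ?_⟩
      rw [map_smul]
      change c • regularRep cs F (piElt cs F w) (Finsupp.single 1 1) = _
      rw [regularRep_piElt, Finsupp.smul_single, smul_eq_mul, mul_one]
  have := LinearMap.finrank_le_finrank_of_surjective hf
  rwa [Module.finrank_finsupp_self, ← Nat.card_eq_fintype_card] at this

theorem linearIndependent_piBarElt : LinearIndependent F (piBarElt cs F) := by
  cases nonempty_fintype W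
  apply linearIndependent_of_top_le_span_of_card_eq_finrank (span_piBarElt cs F).ge
  apply le_antisymm
  · simpa using card_le_finrank_hecke F cs
  · have := finrank_range_le_card (R := F) (piBarElt cs F)
    rwa [Set.finrank, span_piBarElt, finrank_top] at this

/-- The basis `π̄_w` of the 0-Hecke algebra. -/
noncomputable def piBarBasis : Module.Basis W F (Hecke F M) :=
  Module.Basis.mk (linearIndependent_piBarElt cs F) (span_piBarElt cs F).ge

theorem piBarBasis_apply (w : W) : piBarBasis cs F w = piBarElt cs F w := by
  rw [piBarBasis, Module.Basis.mk_apply]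

end Basis

end ZeroHecke

namespace ZeroHecke

/-! ### Leading terms with respect to length. -/

section LeadingTerm

variable {B : Type*} {M : CoxeterMatrix B} {W : Type*} [Group W] (cs : CoxeterSystem M W)
variable (F : Type*) [Field F]

/-- The span of the `π̄_w` with `ℓ(w) > n`. -/
noncomputable def lengthFiltration (n : ℕ) : Submodule F (Hecke F M) :=
  Submodule.span F (piBarElt cs F '' {w | n < cs.length w})

variable {F} in
theorem mul_mem_lengthFiltration {n : ℕ} {x : Hecke F M} (hx : x ∈ lengthFiltration cs F n)
    (a : Hecke F M) : x * a ∈ lengthFiltration cs F n := by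
  refine mul_mem_of_mul_genBar_mem F _ ?_ hx a
  intro x hx i
  induction hx using Submodule.span_induction with
  | mem x hx =>
    obtain ⟨w, hw, rfl⟩ := hx
    by_cases h : cs.IsRightDescent w i
    · rw [piBarElt_mul_genBar_of_isRightDescent cs F h]
      exact Submodule.neg_mem _ (Submodule.subset_span ⟨w, hw, rfl⟩)
    · rw [piBarElt_mul_genBar_of_not_isRightDescent cs F h]
      refine Submodule.subset_span ⟨_, ?_, rfl⟩
      rw [Set.mem_ofPred_eq] at hw ⊢
      rw [cs.not_isRightDescent_iff.1 h]
      omega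
  | zero => simp
  | add x y _ _ hx hy => rw [add_mul]; exact Submodule.add_mem _ hx hy
  | smul c x _ hx => rw [smul_mul_assoc]; exact Submodule.smul_mem _ c hx

variable {F} in
/-- `x` is the sum of `c π̄_w` and of multiples of `π̄_v` with `ℓ(v) > ℓ(w)`. -/
def HasLeadingTerm (w : W) (c : F) (x : Hecke F M) : Prop :=
  x - c • piBarElt cs F w ∈ lengthFiltration cs F (cs.length w)

theorem hasLeadingTerm_piBarElt (w : W) : HasLeadingTerm cs w 1 (piBarElt cs F w) := by
  simp [HasLeadingTerm]

variable {F} {cs}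

theorem HasLeadingTerm.mul_genBar {w : W} {c : F} {x : Hecke F M} (h : HasLeadingTerm cs w c x)
    {i : B} (hi : cs.IsRightDescent w i) : HasLeadingTerm cs w (-c) (x * genBar F M i) := by
  have h1 := mul_mem_lengthFiltration cs h (genBar F M i)
  rw [sub_mul, smul_mul_assoc, piBarElt_mul_genBar_of_isRightDescent cs F hi, smul_neg] at h1
  rwa [HasLeadingTerm, neg_smul]

theorem HasLeadingTerm.mul_gen {w : W} {c : F} {x : Hecke F M} (h : HasLeadingTerm cs w c x)
    {i : B} (hi : ¬ cs.IsRightDescent w i) : HasLeadingTerm cs w c (x * gen F M i) := by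
  have h1 := mul_mem_lengthFiltration cs h (gen F M i)
  have h2 : piBarElt cs F w * genBar F M i ∈ lengthFiltration cs F (cs.length w) := by
    rw [piBarElt_mul_genBar_of_not_isRightDescent cs F hi]
    refine Submodule.subset_span ⟨_, ?_, rfl⟩
    rw [Set.mem_ofPred_eq, cs.not_isRightDescent_iff.1 hi]
    omega
  rw [HasLeadingTerm]
  convert add_mem h1 (Submodule.smul_mem _ c h2) using 1
  rw [sub_mul, gen_eq, smul_mul_assoc, mul_add (piBarElt _ _ _),
    mul_one, smul_add]
  abel

theorem HasLeadingTerm.mul_prod_gen {w : W} {c : F} {x : Hecke F M} (h : HasLeadingTerm cs w c x)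
    {ω : List B} (hω : ∀ i ∈ ω, ¬ cs.IsRightDescent w i) :
    HasLeadingTerm cs w c (x * (ω.map (gen F M)).prod) := by
  induction ω generalizing x with
  | nil => simpa using h
  | cons i ω ih =>
    rw [List.map_cons, List.prod_cons, ← mul_assoc]
    exact ih (h.mul_gen (hω i (by simp))) fun j hj => hω j (by simp [hj])

theorem HasLeadingTerm.mul_prod_genBar {w : W} {c : F} {x : Hecke F M}
    (h : HasLeadingTerm cs w c x) {ω : List B} (hω : ∀ i ∈ ω, cs.IsRightDescent w i) :
    HasLeadingTerm cs w ((-1) ^ ω.length * c) (x * (ω.map (genBar F M)).prod) := by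
  induction ω generalizing x c with
  | nil => simpa using h
  | cons i ω ih =>
    rw [List.map_cons, List.prod_cons, ← mul_assoc]
    convert ih (h.mul_genBar (hω i (by simp))) fun j hj => hω j (by simp [hj]) using 1
    rw [List.length_cons, pow_succ]
    ring

variable [Finite W]

theorem repr_eq_zero_of_mem_lengthFiltration {n : ℕ} {x : Hecke F M}
    (hx : x ∈ lengthFiltration cs F n) {w : W} (hw : cs.length w ≤ n) :
    (piBarBasis cs F).repr x w = 0 := by
  induction hx using Submodule.span_induction with
  | mem x hx =>
    obtain ⟨v, hv, rfl⟩ := hx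
    rw [← piBarBasis_apply, Module.Basis.repr_self, Finsupp.single_eq_of_ne]
    rintro rfl
    exact hw.not_gt hv
  | zero => simp
  | add x y _ _ hx hy => simp [hx, hy]
  | smul c x _ hx => simp [hx]

theorem HasLeadingTerm.repr_eq {w : W} {c : F} {x : Hecke F M} (h : HasLeadingTerm cs w c x)
    {v : W} (hv : cs.length v ≤ cs.length w) :
    (piBarBasis cs F).repr x v = Finsupp.single w c v := by
  have h1 := repr_eq_zero_of_mem_lengthFiltration h hv
  rw [map_sub, map_smul, ← piBarBasis_apply, Module.Basis.repr_self, Finsupp.sub_apply,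
    sub_eq_zero, Finsupp.smul_single, smul_eq_mul, mul_one] at h1
  exact h1

/-- A family with distinct leading terms is linearly independent. -/
theorem linearIndependent_of_hasLeadingTerm {ι : Type*} {w : ι → W} (hw : Function.Injective w)
    {c : ι → F} (hc : ∀ i, c i ≠ 0) {f : ι → Hecke F M}
    (hf : ∀ i, HasLeadingTerm cs (w i) (c i) (f i)) : LinearIndependent F f := by
  classical
  rw [linearIndependent_iff']
  intro s g hg
  by_contra! hne
  obtain ⟨i, hi, hgi⟩ := hne
  -- Take a term of minimal length with nonzero coefficient. No other term contributes to the
  -- coordinate at `w k`.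
  obtain ⟨k, hk, hmin⟩ := Finset.exists_min_image (s.filter fun i => g i ≠ 0)
    (fun i => cs.length (w i)) ⟨i, by simp [hi, hgi]⟩
  rw [Finset.mem_filter] at hk
  have h1 := congrArg (fun x => (piBarBasis cs F).repr x (w k)) hg
  simp only [map_sum, map_smul, map_zero, Finsupp.coe_finsetSum, Finset.sum_apply,
    Finsupp.smul_apply, Finsupp.coe_zero, Pi.zero_apply, smul_eq_mul] at h1
  rw [Finset.sum_eq_single_of_mem k hk.1] at h1
  · rw [(hf k).repr_eq le_rfl, Finsupp.single_eq_same] at h1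
    exact (mul_ne_zero hk.2 (hc k)) h1
  · intro j hj hjk
    by_cases h0 : g j = 0
    · rw [h0, zero_mul]
    · rw [(hf j).repr_eq (hmin j (by simp [hj, h0])), Finsupp.single_eq_of_ne, mul_zero]
      exact fun h => hjk (hw h).symm

end LeadingTerm

/-! ### The basis of the left ideal `H_W(0) π̄_{w_0(I)} π_{w_0(J \ I)}`. -/

section LeftIdeals

variable {B : Type*} {M : CoxeterMatrix B} {W : Type*} [Group W] [Finite W]
  (cs : CoxeterSystem M W) (F : Type*) [Field F] (I J : Set B)

variable {F I J}

theorem HasLeadingTerm.mul_piBarElt_longest {w : W} {c : F} {x : Hecke F M}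
    (h : HasLeadingTerm cs w c x) (hI : I ⊆ descentSet cs w) :
    HasLeadingTerm cs w ((-1) ^ (reducedWord cs (longest cs I)).length * c)
      (x * piBarElt cs F (longest cs I)) :=
  h.mul_prod_genBar fun _ hi => hI (mem_of_mem_reducedWord_longest cs hi)

theorem HasLeadingTerm.mul_piElt_longest {w : W} {c : F} {x : Hecke F M}
    (h : HasLeadingTerm cs w c x) (hI : ∀ i ∈ I, i ∉ descentSet cs w) :
    HasLeadingTerm cs w c (x * piElt cs F (longest cs I)) :=
  h.mul_prod_gen fun _ hi => hI _ (mem_of_mem_reducedWord_longest cs hi)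

theorem HasLeadingTerm.mul_projGen {w : W} {c : F} {x : Hecke F M}
    (h : HasLeadingTerm cs w c x) (hI : I ⊆ descentSet cs w) (hJ : descentSet cs w ⊆ Jᶜ ∪ I) :
    HasLeadingTerm cs w ((-1) ^ (reducedWord cs (longest cs I)).length * c)
      (x * projGen cs F I J) := by
  rw [projGen, ← mul_assoc]
  refine (h.mul_piBarElt_longest cs hI).mul_piElt_longest cs fun i hi hd => ?_
  rcases hJ hd with h | h
  exacts [h hi.1, hi.2 h]

variable (F)

theorem piBarElt_mul_piBarElt_longest {w : W} (hI : I ⊆ descentSet cs w) :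
    piBarElt cs F w * piBarElt cs F (longest cs I) =
      (-1 : F) ^ (reducedWord cs (longest cs I)).length • piBarElt cs F w := by
  have h (ω : List B) (hω : ∀ i ∈ ω, cs.IsRightDescent w i) :
      piBarElt cs F w * (ω.map (genBar F M)).prod = (-1 : F) ^ ω.length • piBarElt cs F w := by
    induction ω with
    | nil => simp
    | cons i ω ih =>
      rw [List.map_cons, List.prod_cons, ← mul_assoc,
        piBarElt_mul_genBar_of_isRightDescent cs F (hω i (by simp)), neg_mul,
        ih fun j hj => hω j (by simp [hj]), List.length_cons, pow_succ]
      simp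
  exact h _ fun i hi => hI (mem_of_mem_reducedWord_longest cs hi)

theorem repr_mul_genBar_eq_zero (x : Hecke F M) {w : W} {i : B} (h : ¬ cs.IsRightDescent w i) :
    (piBarBasis cs F).repr (x * genBar F M i) w = 0 := by
  have hx : x ∈ Submodule.span F (Set.range (piBarElt cs F)) := by rw [span_piBarElt]; trivial
  induction hx using Submodule.span_induction with
  | mem x hx =>
    obtain ⟨v, rfl⟩ := hx
    by_cases hv : cs.IsRightDescent v i
    · rw [piBarElt_mul_genBar_of_isRightDescent cs F hv, map_neg, ← piBarBasis_apply,
        Module.Basis.repr_self, Finsupp.neg_apply, Finsupp.single_eq_of_ne, neg_zero]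
      rintro rfl
      exact h hv
    · rw [piBarElt_mul_genBar_of_not_isRightDescent cs F hv, ← piBarBasis_apply,
        Module.Basis.repr_self, Finsupp.single_eq_of_ne]
      rintro rfl
      rw [cs.isRightDescent_iff_not_isRightDescent_mul, not_not,
        cs.simple_mul_simple_cancel_right] at h
      exact hv h
  | zero => simp
  | add x y _ _ hx hy => simp [add_mul, hx, hy]
  | smul c x _ hx => simp [hx]

/-- For `i ∈ I` the element `π̄_{w_0(I)}` is minus its own product with `π̄_i`, and right multiples
of the form `x π̄_i` involve only those `w` with descent `i`. -/
theorem repr_mul_piBarElt_longest_eq_zero (x : Hecke F M) {w : W} (h : ¬ I ⊆ descentSet cs w) :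
    (piBarBasis cs F).repr (x * piBarElt cs F (longest cs I)) w = 0 := by
  obtain ⟨i, hi, hw⟩ := Set.not_subset.1 h
  have h1 := repr_mul_genBar_eq_zero cs F (x * piBarElt cs F (longest cs I)) hw
  rwa [mul_assoc, piBarElt_mul_genBar_of_isRightDescent cs F (isRightDescent_longest cs hi),
    mul_neg, map_neg, Finsupp.neg_apply, neg_eq_zero] at h1

/-- A factor `π̄_i` can be split off `π̄_w` on the right and `π_i` off `π_{w_0(I)}` on the left, and
`π̄_i π_i = 0`. -/
theorem piBarElt_mul_piElt_longest_eq_zero {w : W} {i : B} (hi : i ∈ I)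
    (hw : i ∈ descentSet cs w) : piBarElt cs F w * piElt cs F (longest cs I) = 0 := by
  have h1 := piBarElt_mul_genBar_of_isRightDescent cs F hw
  rw [← neg_eq_zero, ← neg_mul, ← h1, ← gen_mul_piElt cs F (isLeftDescent_longest cs hi), mul_assoc,
    ← mul_assoc (genBar F M i), genBar_mul_gen, zero_mul, mul_zero]

variable (I J)

/-- The elements of `W` that index the basis of `H_W(0) π̄_{w_0(I)} π_{w_0(J \ I)}`. -/
abbrev BasisIndex : Type _ := {w : W // I ⊆ descentSet cs w ∧ descentSet cs w ⊆ Jᶜ ∪ I}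

theorem piBarElt_mul_piElt_mem_projIJ (w : BasisIndex cs I J) :
    piBarElt cs F w.1 * piElt cs F (longest cs (J \ I)) ∈ projIJ cs F I J := by
  rw [projIJ, Submodule.mem_span_singleton]
  -- `π̄_w` is an eigenvector of right multiplication by `π̄_{w_0(I)}`; the sign in the witness
  -- cancels its eigenvalue.
  refine ⟨(-1 : F) ^ (reducedWord cs (longest cs I)).length • piBarElt cs F w.1, ?_⟩
  rw [smul_eq_mul, projGen, ← mul_assoc, smul_mul_assoc, piBarElt_mul_piBarElt_longest cs F w.2.1,
    smul_smul, ← mul_pow]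
  simp

theorem hasLeadingTerm_piBarElt_mul_piElt (w : BasisIndex cs I J) :
    HasLeadingTerm cs w.1 1 (piBarElt cs F w.1 * piElt cs F (longest cs (J \ I))) :=
  (hasLeadingTerm_piBarElt cs F w.1).mul_piElt_longest cs fun i hi hd => by
    rcases w.2.2 hd with h | h
    exacts [h hi.1, hi.2 h]

theorem mem_span_of_mem_projIJ {x : Hecke F M} (hx : x ∈ projIJ cs F I J) :
    x ∈ Submodule.span F (Set.range fun w : BasisIndex cs I J =>
      piBarElt cs F w.1 * piElt cs F (longest cs (J \ I))) := by
  cases nonempty_fintype W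
  rw [projIJ, Submodule.mem_span_singleton] at hx
  obtain ⟨a, rfl⟩ := hx
  rw [smul_eq_mul, projGen, ← mul_assoc,
    ← (piBarBasis cs F).sum_repr (a * piBarElt cs F (longest cs I)), Finset.sum_mul]
  refine Submodule.sum_mem _ fun w _ => ?_
  rw [smul_mul_assoc, piBarBasis_apply]
  by_cases hI : I ⊆ descentSet cs w
  · apply Submodule.smul_mem
    by_cases hJ : descentSet cs w ⊆ Jᶜ ∪ I
    · exact Submodule.subset_span ⟨⟨w, hI, hJ⟩, rfl⟩
    · obtain ⟨i, hi, hi'⟩ := Set.not_subset.1 hJ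
      rw [piBarElt_mul_piElt_longest_eq_zero cs F (i := i) _ hi]
      · exact Submodule.zero_mem _
      · simpa using hi'
  · rw [repr_mul_piBarElt_longest_eq_zero cs F a hI, zero_smul]
    exact Submodule.zero_mem _

/-- The basis of `H_W(0) π̄_{w_0(I)} π_{w_0(J \ I)}`. -/
noncomputable def projIJBasis : Module.Basis (BasisIndex cs I J) F (projIJ cs F I J) :=
  Module.Basis.mk (v := fun w => ⟨_, piBarElt_mul_piElt_mem_projIJ cs F I J w⟩)
    (LinearIndependent.of_comp ((projIJ cs F I J).restrictScalars F).subtype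
      (linearIndependent_of_hasLeadingTerm Subtype.val_injective (fun _ => one_ne_zero)
        (hasLeadingTerm_piBarElt_mul_piElt cs F I J))) <| by
    rintro ⟨x, hx⟩ -
    have h := mem_span_of_mem_projIJ cs F I J hx
    have hr := Submodule.map_span ((projIJ cs F I J).restrictScalars F).subtype
      (Set.range fun w => ⟨_, piBarElt_mul_piElt_mem_projIJ cs F I J w⟩)
    rw [← Set.range_comp] at hr
    obtain ⟨y, hy, hyx⟩ := hr.ge h
    rwa [show (⟨x, hx⟩ : projIJ cs F I J) = y from Subtype.ext hyx.symm]

theorem projIJBasis_apply (w : BasisIndex cs I J) :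
    (projIJBasis cs F I J w : Hecke F M) =
      piBarElt cs F w.1 * piElt cs F (longest cs (J \ I)) := by
  rw [projIJBasis, Module.Basis.mk_apply]

end LeftIdeals

end ZeroHecke

namespace ZeroHecke

/-! ### Decomposition into the modules `P_{I ∪ K}`. -/

section DirectSumDecomposition

theorem dfinsuppBasis_apply {ι R : Type*} {V : ι → Type*} {η : ι → Type*} [DecidableEq ι]
    [Semiring R] [∀ i, AddCommMonoid (V i)] [∀ i, Module R (V i)]
    (b : ∀ i, Module.Basis (η i) R (V i)) (x : Σ i, η i) :
    DFinsupp.basis b x = DFinsupp.single x.1 (b x.1 x.2) := by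
  change (DFinsupp.mapRange.linearEquiv fun i => (b i).repr).symm
    (sigmaFinsuppEquivDFinsupp (Finsupp.single x 1)) = _
  rw [sigmaFinsuppEquivDFinsupp_single, LinearEquiv.symm_apply_eq]
  simp

theorem BasisIndex.descentSet_eq {B : Type*} {M : CoxeterMatrix B} {W : Type*} [Group W]
    (cs : CoxeterSystem M W) {L : Set B} (w : BasisIndex cs L Set.univ) :
    descentSet cs w.1 = L := by
  apply le_antisymm _ w.2.1
  simpa using w.2.2

variable {B : Type*} {M : CoxeterMatrix B} {W : Type*} [Group W] [Finite W]
  (cs : CoxeterSystem M W) (F : Type*) [Field F] (I J : Set B)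

theorem projI_eq_projIJ_univ (L : Set B) : projI cs F L = projIJ cs F L Set.univ := by
  rw [projI, projIJ, projGen, Set.compl_eq_univ_sdiff]

/-- Right multiplication by `π̄_{w_0(I)} π_{w_0(J \ I)}`, as a map onto the left ideal that this
element generates. -/
noncomputable def mulProjGen : Hecke F M →ₗ[Hecke F M] projIJ cs F I J :=
  LinearMap.toSpanSingleton _ _ ⟨projGen cs F I J, Submodule.mem_span_singleton_self _⟩

theorem coe_mulProjGen (x : Hecke F M) :
    (mulProjGen cs F I J x : Hecke F M) = x * projGen cs F I J := rfl

open Classical in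
/-- The sum of the right multiplications by `π̄_{w_0(I)} π_{w_0(J \ I)}` on the `P_{I ∪ K}`. -/
noncomputable def directSumToProjIJ :
    (⨁ K : {K : Set B // K ⊆ Jᶜ}, projIJ cs F (I ∪ K.1) Set.univ) →ₗ[Hecke F M] projIJ cs F I J :=
  DirectSum.toModule (Hecke F M) _ _ fun K =>
    (mulProjGen cs F I J).comp (projIJ cs F (I ∪ K.1) Set.univ).subtype

variable {I J}

/-- The elements with `I ⊆ D(w) ⊆ Jᶜ ∪ I`, sorted by `D(w)`. -/
def sigmaEquivBasisIndex (hIJ : I ⊆ J) :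
    (Σ K : {K : Set B // K ⊆ Jᶜ}, BasisIndex cs (I ∪ K.1) Set.univ) ≃ BasisIndex cs I J where
  toFun w := ⟨w.2.1, by
    rw [w.2.descentSet_eq cs]
    exact ⟨Set.subset_union_left, Set.union_subset Set.subset_union_right
      (w.1.2.trans Set.subset_union_left)⟩⟩
  invFun w := ⟨⟨descentSet cs w.1 \ I, fun i hi => (w.2.2 hi.1).resolve_right hi.2⟩, w.1, by
    rw [Set.union_sdiff_cancel w.2.1]
    simp⟩
  left_inv := by
    rintro ⟨⟨K, hK⟩, w, hw⟩
    have h := BasisIndex.descentSet_eq cs ⟨w, hw⟩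
    have : descentSet cs w \ I = K := by
      rw [h]
      apply Set.union_sdiff_cancel_left
      rintro i ⟨hi, hi'⟩
      exact hK hi' (hIJ hi)
    subst this
    rfl
  right_inv w := rfl

/-- Basis vectors of the summands keep their leading terms up to sign, and these are distinct across
summands because `D(w) = I ∪ K` determines `K`. Their number is the dimension of the target. -/
theorem directSumToProjIJ_bijective (hIJ : I ⊆ J) :
    Function.Bijective (directSumToProjIJ cs F I J) := by
  classical
  let b : Module.Basis (Σ K : {K : Set B // K ⊆ Jᶜ}, BasisIndex cs (I ∪ K.1) Set.univ) F
    (⨁ K : {K : Set B // K ⊆ Jᶜ}, projIJ cs F (I ∪ K.1) Set.univ) :=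
    DFinsupp.basis fun K => projIJBasis cs F (I ∪ K.1) Set.univ
  let f : (⨁ K : {K : Set B // K ⊆ Jᶜ}, projIJ cs F (I ∪ K.1) Set.univ) →ₗ[F] projIJ cs F I J :=
    (directSumToProjIJ cs F I J).restrictScalars F
  have hb (w) : (f (b w) : Hecke F M) =
      piBarElt cs F w.2.1 * piElt cs F (longest cs (Set.univ \ (I ∪ w.1.1))) *
        projGen cs F I J := by
    rw [← projIJBasis_apply, ← coe_mulProjGen]
    have h1 : b w = DirectSum.lof (Hecke F M) _ (fun K : {K : Set B // K ⊆ Jᶜ} =>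
        projIJ cs F (I ∪ K.1) Set.univ) w.1 (projIJBasis cs F (I ∪ w.1.1) Set.univ w.2) :=
      dfinsuppBasis_apply _ w
    rw [h1]
    congr 1
    exact DirectSum.toModule_lof ..
  have hlin : LinearIndependent F (f ∘ b) := by
    apply LinearIndependent.of_comp ((projIJ cs F I J).restrictScalars F).subtype
    refine linearIndependent_of_hasLeadingTerm (cs := cs)
      (w := fun w => (sigmaEquivBasisIndex cs hIJ w).1)
      (c := fun _ => (-1) ^ (reducedWord cs (longest cs I)).length * 1)
      (Subtype.val_injective.comp (Equiv.injective _)) (fun _ => by simp) fun w => ?_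
    have h1 := (hasLeadingTerm_piBarElt_mul_piElt cs F _ _ w.2).mul_projGen cs (I := I) (J := J)
      (sigmaEquivBasisIndex cs hIJ w).2.1 (sigmaEquivBasisIndex cs hIJ w).2.2
    rw [← hb] at h1
    exact h1
  have := Fintype.ofFinite (BasisIndex cs I J)
  have := Fintype.ofEquiv _ (sigmaEquivBasisIndex cs hIJ).symm
  have := Module.Finite.of_basis (projIJBasis cs F I J)
  let b' := basisOfLinearIndependentOfCardEqFinrank' (f ∘ b) hlin (by
    rw [Module.finrank_eq_card_basis (projIJBasis cs F I J)]
    exact Fintype.card_congr (sigmaEquivBasisIndex cs hIJ))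
  have hf : f = (b.equiv b' (Equiv.refl _)).toLinearMap := b.ext fun w => by simp [b']
  have hbij : Function.Bijective f := by
    rw [hf]
    exact (b.equiv b' (Equiv.refl _)).bijective
  exact hbij

theorem nonempty_projIJ_equiv_directSum (hIJ : I ⊆ J) :
    Nonempty (projIJ cs F I J ≃ₗ[Hecke F M]
      ⨁ K : {K : Set B // K ⊆ Jᶜ}, projI cs F (I ∪ K.1)) := by
  have h (g : {K : Set B // K ⊆ Jᶜ} → Submodule (Hecke F M) (Hecke F M))
      (hg : g = fun K => projIJ cs F (I ∪ K.1) Set.univ) :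
      Nonempty (projIJ cs F I J ≃ₗ[Hecke F M] ⨁ K : {K : Set B // K ⊆ Jᶜ}, g K) := by
    subst hg
    exact ⟨(LinearEquiv.ofBijective _ (directSumToProjIJ_bijective cs F hIJ)).symm⟩
  exact h _ (funext fun K => projI_eq_projIJ_univ cs F _)

end DirectSumDecomposition

end ZeroHecke

namespace ZeroHecke

/-! ### Induction from a cyclic left ideal of a subalgebra. -/

section Induction

variable {F A : Type*} [Field F] [Ring A] [Algebra F A] (C : Subalgebra F A) (z : A)

/-- The multiplication map from the module induced from `C z` to `A z`. -/
noncomputable def inducedToSpan :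
    Induced C (Submodule.span C {z}) →ₗ[A] Submodule.span A {z} :=
  Submodule.liftQ _
    (TensorProduct.AlgebraTensorModule.lift
      ({ toFun := fun a =>
          { toFun := fun n => ⟨a * n.1, Submodule.smul_mem _ a
              (Submodule.span_le_restrictScalars C A {z} n.2)⟩
            map_add' := fun m n => Subtype.ext (mul_add a m.1 n.1)
            map_smul' := fun c n => Subtype.ext (mul_smul_comm c a n.1) }
         map_add' := fun a b => LinearMap.ext fun n => Subtype.ext (add_mul a b n.1)
         map_smul' := fun a b => LinearMap.ext fun n => Subtype.ext (mul_assoc a b n.1) } :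
        A →ₗ[A] Submodule.span C {z} →ₗ[F] Submodule.span A {z})) <| by
    rw [Submodule.span_le]
    rintro _ ⟨a, c, n, rfl⟩
    rw [SetLike.mem_coe, LinearMap.mem_ker, map_sub, sub_eq_zero]
    exact Subtype.ext (mul_assoc a c n.1)

theorem induced_mk_tmul_smul {N : Type*} [AddCommGroup N] [Module F N] [Module C N]
    [IsScalarTower F C N] (a : A) (c : C) (n : N) :
    (Submodule.Quotient.mk (a ⊗ₜ[F] (c • n)) : Induced C N) =
      Submodule.Quotient.mk ((a * (c : A)) ⊗ₜ[F] n) := by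
  refine ((Submodule.Quotient.eq _).2 ?_).symm
  exact Submodule.subset_span ⟨a, c, n, rfl⟩

theorem exists_eq_mk_tmul {N : Type*} [AddCommGroup N] [Module F N] [Module C N]
    [IsScalarTower F C N] {n₀ : N} (hn₀ : ∀ n : N, ∃ c : C, c • n₀ = n) (x : Induced C N) :
    ∃ a : A, x = Submodule.Quotient.mk (a ⊗ₜ[F] n₀) := by
  obtain ⟨x, rfl⟩ := Submodule.Quotient.mk_surjective _ x
  induction x with
  | zero => exact ⟨0, by rw [TensorProduct.zero_tmul]⟩
  | tmul a n =>
    obtain ⟨c, rfl⟩ := hn₀ n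
    exact ⟨a * c, induced_mk_tmul_smul C a c n₀⟩
  | add x y hx hy =>
    obtain ⟨a, ha⟩ := hx
    obtain ⟨b, hb⟩ := hy
    refine ⟨a + b, ?_⟩
    rw [Submodule.Quotient.mk_add, ha, hb, TensorProduct.add_tmul, Submodule.Quotient.mk_add]

/-- If `z = z c z` for some `c ∈ C`, then the module induced from `C z` is `A z`. -/
theorem inducedToSpan_bijective (hz : z ∈ C) {c : A} (hc : c ∈ C) (h : z * c * z = z) :
    Function.Bijective (inducedToSpan C z) := by
  constructor
  · rw [injective_iff_map_eq_zero]
    intro x hx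
    obtain ⟨a, rfl⟩ := exists_eq_mk_tmul C
      (n₀ := (⟨z, Submodule.mem_span_singleton_self z⟩ : Submodule.span C {z}))
      (fun n => (Submodule.mem_span_singleton.1 n.2).imp fun _ h => Subtype.ext h) x
    have h0 : a * z = 0 := congrArg Subtype.val hx
    -- Writing `z = (z c) z` moves `z c` across the tensor sign, next to `a`, where `a z = 0`.
    have hs : (⟨z, Submodule.mem_span_singleton_self z⟩ : Submodule.span C {z}) =
        (⟨z * c, C.mul_mem hz hc⟩ : C) • ⟨z, Submodule.mem_span_singleton_self z⟩ :=
      Subtype.ext h.symm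
    rw [hs, induced_mk_tmul_smul, ← mul_assoc, h0, zero_mul, TensorProduct.zero_tmul,
      Submodule.Quotient.mk_zero]
  · rintro ⟨y, hy⟩
    obtain ⟨a, rfl⟩ := Submodule.mem_span_singleton.1 hy
    exact ⟨Submodule.Quotient.mk (a ⊗ₜ ⟨z, Submodule.mem_span_singleton_self z⟩), rfl⟩

/-- If right multiplication by `z` is injective on `A z`, then `z` is von Neumann regular in every
finite-dimensional subalgebra that contains it. -/
theorem exists_mul_mul_eq_self [Module.Finite F A] (hz : z ∈ C)
    (hinj : ∀ x ∈ Submodule.span A {z}, x * z = 0 → x = 0) : ∃ c ∈ C, z * c * z = z := by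
  let R : Submodule.span C {z} →ₗ[F] Submodule.span C {z} :=
    { toFun := fun x => ⟨x.1 * z, by
        obtain ⟨c, hc⟩ := Submodule.mem_span_singleton.1 x.2
        rw [← hc]
        exact Submodule.mem_span_singleton.2 ⟨c * ⟨z, hz⟩, rfl⟩⟩
      map_add' := fun x y => Subtype.ext (add_mul x.1 y.1 z)
      map_smul' := fun r x => Subtype.ext (smul_mul_assoc r x.1 z) }
  have hle := Submodule.span_le_restrictScalars C A {z}
  have hR : Function.Injective R := by
    rw [injective_iff_map_eq_zero]
    intro x hx
    exact Subtype.ext (hinj x.1 (hle x.2) (congrArg Subtype.val hx))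
  have : Module.Finite F (Submodule.span C {z}) :=
    inferInstanceAs (Module.Finite F ((Submodule.span C {z}).restrictScalars F))
  -- Right multiplication by `z` on the finite-dimensional `C z` is injective, hence hits `z`: some
  -- `y = c z` has `y z = z`. Then `z c z - z` is killed by `z` on the right.
  obtain ⟨⟨y, hy⟩, hyz⟩ := LinearMap.injective_iff_surjective.1 hR
    ⟨z, Submodule.mem_span_singleton_self z⟩
  have hyz : y * z = z := congrArg Subtype.val hyz
  obtain ⟨c, rfl⟩ := Submodule.mem_span_singleton.1 hy
  refine ⟨c, c.2, ?_⟩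
  have h1 : z * (c * z) - z = 0 := by
    apply hinj
    · exact Submodule.sub_mem _ (Submodule.mem_span_singleton.2 ⟨z * c, mul_assoc _ _ _⟩)
        (Submodule.mem_span_singleton_self z)
    · have hyz : (c * z : A) * z = z := hyz
      rw [sub_mul, mul_assoc, hyz, sub_self]
  rw [mul_assoc]
  exact sub_eq_zero.1 h1

end Induction

/-! ### Induction from `H_{W_J}(0)`. -/

section ParabolicInduction

variable {B : Type*} {M : CoxeterMatrix B} {W : Type*} [Group W] [Finite W]
  (cs : CoxeterSystem M W) (F : Type*) [Field F] {I J : Set B}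

theorem gen_mem_parabolicAlgebra {i : B} (hi : i ∈ J) : gen F M i ∈ parabolicAlgebra F M J :=
  Algebra.subset_adjoin ⟨i, hi, rfl⟩

theorem projGen_mem_parabolicAlgebra (hIJ : I ⊆ J) : projGen cs F I J ∈ parabolicAlgebra F M J := by
  apply mul_mem
  · apply list_prod_mem
    simp only [List.mem_map]
    rintro _ ⟨i, hi, rfl⟩
    exact sub_mem (gen_mem_parabolicAlgebra F (hIJ (mem_of_mem_reducedWord_longest cs hi)))
      (one_mem _)
  · apply list_prod_mem
    simp only [List.mem_map]
    rintro _ ⟨i, hi, rfl⟩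
    exact gen_mem_parabolicAlgebra F (mem_of_mem_reducedWord_longest cs hi).1

/-- Right multiplication by the generator preserves the leading terms of the basis vectors up to
sign, so their images remain independent. -/
theorem eq_zero_of_mul_projGen_eq_zero {x : Hecke F M} (hx : x ∈ projIJ cs F I J)
    (h : x * projGen cs F I J = 0) : x = 0 := by
  cases nonempty_fintype (BasisIndex cs I J)
  let b := projIJBasis cs F I J
  have hlin : LinearIndependent F fun w => (b w : Hecke F M) * projGen cs F I J :=
    linearIndependent_of_hasLeadingTerm (cs := cs) Subtype.val_injective
      (c := fun _ => (-1) ^ (reducedWord cs (longest cs I)).length * 1) (fun _ => by simp)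
      fun w => by
        rw [projIJBasis_apply]
        exact (hasLeadingTerm_piBarElt_mul_piElt cs F I J w).mul_projGen cs w.2.1 w.2.2
  have hsum := congrArg Subtype.val (b.sum_repr ⟨x, hx⟩)
  rw [Submodule.coe_sum] at hsum
  have hsum' : ∑ w, b.repr ⟨x, hx⟩ w • (b w : Hecke F M) = x := hsum
  rw [← hsum', Finset.sum_mul] at h
  simp only [smul_mul_assoc] at h
  have h0 := Fintype.linearIndependent_iff.1 hlin _ h
  rw [← hsum']
  simp [h0]

theorem nonempty_induced_equiv_projIJ (hIJ : I ⊆ J) :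
    Nonempty (Induced (parabolicAlgebra F M J) (projParabolic cs F I J)
      ≃ₗ[Hecke F M] projIJ cs F I J) := by
  have := finite_hecke F cs
  have hz := projGen_mem_parabolicAlgebra cs F hIJ
  obtain ⟨c, hc, h⟩ := exists_mul_mul_eq_self (parabolicAlgebra F M J) (projGen cs F I J) hz
    fun x hx => eq_zero_of_mul_projGen_eq_zero cs F hx
  exact ⟨LinearEquiv.ofBijective _ (inducedToSpan_bijective _ _ hz hc h)⟩

end ParabolicInduction

end ZeroHecke

theorem mainTheorem1 (F : Type*) [Field F] {B : Type*} {M : CoxeterMatrix B}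
    {W : Type*} [Group W] [Finite W] (cs : CoxeterSystem M W) (I J : Set B) :
    (∃ b : Module.Basis
        {w : W // I ⊆ ZeroHecke.descentSet cs w ∧ ZeroHecke.descentSet cs w ⊆ Jᶜ ∪ I} F
        (ZeroHecke.projIJ cs F I J),
      ∀ w, (b w : ZeroHecke.Hecke F M) =
        ZeroHecke.piBarElt cs F w.1 * ZeroHecke.piElt cs F (ZeroHecke.longest cs (J \ I))) ∧
    (I ⊆ J →
      Nonempty
        (ZeroHecke.Induced (ZeroHecke.parabolicAlgebra F M J) (ZeroHecke.projParabolic cs F I J)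
          ≃ₗ[ZeroHecke.Hecke F M] ZeroHecke.projIJ cs F I J) ∧
      Nonempty
        (ZeroHecke.projIJ cs F I J ≃ₗ[ZeroHecke.Hecke F M]
          ⨁ K : {K : Set B // K ⊆ Jᶜ}, ZeroHecke.projI cs F (I ∪ K.1))) := by
  exact ⟨⟨ZeroHecke.projIJBasis cs F I J, ZeroHecke.projIJBasis_apply cs F I J⟩, fun hIJ =>
    ⟨ZeroHecke.nonempty_induced_equiv_projIJ cs F hIJ,
      ZeroHecke.nonempty_projIJ_equiv_directSum cs F hIJ⟩⟩
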